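/- Let $L>0$ and $a<b$, let $\Omega=(\mathbb{R}/L\mathbb{Z})\times(a,b)$ be the periodic channel, let $p\in(2,\infty]$, and let $m>0$ and $K\in\mathbb{R}$. There is $\varepsilon=\varepsilon(m,K,\Omega,p)>0$ with the following property. Let $v\in C^1([a,b])$ satisfy $\inf_{[a,b]}|v|\ge m$ and $\|v\|_{C^1}:=\sup_{[a,b]}|v|+\sup_{[a,b]}|v'|\le K$ (so that $\bar u=(v(y),0)$ is a non-stagnant shear flow). Then every stationary Euler state $u$ in $\Omega$, that is, every weakly differentiable vector field $u$ on $\Omega$ for which there is a pressure $P$ on $\Omega$ with $$u\cdot\nabla u=-\nabla P,\qquad \nabla\cdot u=0\quad\text{in }\Omega,\qquad u\cdot\hat n=0\quad\text{on }\partial\Omega$$ (derivatives in the weak sense; the boundary condition in the weak sense $\int_\Omega u\cdot\nabla\varphi=0$ for all $\varphi$ smooth up to the boundary), such that $$\|u-\bar u\|_{W^{1,p}(\Omega)}<\varepsilon,$$ is a shear flow: $u(x,y)=(w(y),0)$ almost everywhere in $\Omega$ for some function $w$. -/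

import Mathlib

open MeasureTheory Set
open scoped ENNReal ContDiff

noncomputable section

/-- The strip `ℝ × (a, b)`. The periodic channel `(ℝ/Lℤ) × (a, b)` is its quotient by the shift
`(x, y) ↦ (x + L, y)`; functions on the channel are functions on the strip that are `L`-periodic
in `x`. -/
def strip (a b : ℝ) : Set (ℝ × ℝ) := univ ×ˢ Ioo a b

/-- One period cell `(0, L) × (a, b)` of the channel; Lebesgue norms on the channel are taken
over it. -/
def cell (L a b : ℝ) : Set (ℝ × ℝ) := Ioo 0 L ×ˢ Ioo a b

/-- `f` (on the strip) is `L`-periodic in `x`, that is, it is a function on the channel. -/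
def IsXPeriodic {E : Type*} (L a b : ℝ) (f : ℝ × ℝ → E) : Prop :=
  ∀ x, ∀ y ∈ Ioo a b, f (x + L, y) = f (x, y)

/-- Test functions on an open set `U` of the plane: `φ ∈ C_c^∞(U)`. -/
structure IsTestFunction (U : Set (ℝ × ℝ)) (φ : ℝ × ℝ → ℝ) : Prop where
  smooth : ContDiff ℝ ∞ φ
  compact : HasCompactSupport φ
  support : tsupport φ ⊆ U

/-- The classical partial derivative in `x`. -/
def dx (φ : ℝ × ℝ → ℝ) (z : ℝ × ℝ) : ℝ := fderiv ℝ φ z (1, 0)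

/-- The classical partial derivative in `y`. -/
def dy (φ : ℝ × ℝ → ℝ) (z : ℝ × ℝ) : ℝ := fderiv ℝ φ z (0, 1)

/-- `g = (∂ₓ f, ∂_y f)` in the sense of weak derivatives on the open set `U`. -/
structure HasWeakGradient (U : Set (ℝ × ℝ)) (f : ℝ × ℝ → ℝ) (g : ℝ × ℝ → ℝ × ℝ) : Prop where
  locInt : LocallyIntegrableOn f U
  locInt_x : LocallyIntegrableOn (fun z => (g z).1) U
  locInt_y : LocallyIntegrableOn (fun z => (g z).2) U
  weak_x : ∀ φ, IsTestFunction U φ →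
    ∫ z in U, f z * dx φ z = -∫ z in U, (g z).1 * φ z
  weak_y : ∀ φ, IsTestFunction U φ →
    ∫ z in U, f z * dy φ z = -∫ z in U, (g z).2 * φ z

/-- The `W^{1,p}` norm on the channel of a scalar function `f`:
`‖f‖_p + ‖∂ₓ f‖_p + ‖∂_y f‖_p` over one period cell. Weak gradients are unique almost everywhere,
so the infimum is over a single class; it is `∞` if `f` has no weak gradient. -/
def sobolevNorm (L a b : ℝ) (p : ℝ≥0∞) (f : ℝ × ℝ → ℝ) : ℝ≥0∞ :=
  ⨅ (g : ℝ × ℝ → ℝ × ℝ) (_ : HasWeakGradient (strip a b) f g),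
    eLpNorm f p (volume.restrict (cell L a b))
      + eLpNorm (fun z => (g z).1) p (volume.restrict (cell L a b))
      + eLpNorm (fun z => (g z).2) p (volume.restrict (cell L a b))

/-- The `W^{1,p}` norm on the channel of a vector field. -/
def sobolevNormVec (L a b : ℝ) (p : ℝ≥0∞) (u : ℝ × ℝ → ℝ × ℝ) : ℝ≥0∞ :=
  sobolevNorm L a b p (fun z => (u z).1) + sobolevNorm L a b p (fun z => (u z).2)

/-- `u` is a stationary Euler state in the channel: there is a pressure `P` on the channel with
`u · ∇u = -∇P` and `div u = 0` in the channel, with weak derivatives, and `u · n = 0` on its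
boundary. The last condition is the weak one: for the divergence-free field `u` it says that
`∫ u · ∇φ = 0` for all test functions `φ` of the plane, which need not vanish on the boundary. -/
structure IsStationaryEuler (L a b : ℝ) (u : ℝ × ℝ → ℝ × ℝ) : Prop where
  periodic : IsXPeriodic L a b u
  euler : ∃ (G₁ G₂ : ℝ × ℝ → ℝ × ℝ) (P : ℝ × ℝ → ℝ),
    HasWeakGradient (strip a b) (fun z => (u z).1) G₁ ∧
    HasWeakGradient (strip a b) (fun z => (u z).2) G₂ ∧
    (∀ᵐ z ∂volume.restrict (strip a b), (G₁ z).1 + (G₂ z).2 = 0) ∧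
    IsXPeriodic L a b P ∧
    HasWeakGradient (strip a b) P (fun z =>
      (-((u z).1 * (G₁ z).1 + (u z).2 * (G₁ z).2),
       -((u z).1 * (G₂ z).1 + (u z).2 * (G₂ z).2)))
  tangent : ∀ φ, IsTestFunction univ φ →
    ∫ z in strip a b, ((u z).1 * dx φ z + (u z).2 * dy φ z) = 0

/-- The shear flow `(v(y), 0)`. -/
def shear (v : ℝ → ℝ) (z : ℝ × ℝ) : ℝ × ℝ := (v z.2, 0)

/-- `u` is, as an element of a Lebesgue space, a shear flow `(w(y), 0)`. -/
def IsShearFlow (a b : ℝ) (u : ℝ × ℝ → ℝ × ℝ) : Prop :=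
  ∃ w : ℝ → ℝ, ∀ᵐ z ∂volume.restrict (strip a b), u z = shear w z

/-- The `C¹([a, b])` norm `sup |v| + sup |v'|`. -/
def c1Norm (a b : ℝ) (v : ℝ → ℝ) : ℝ :=
  (⨆ y : Icc a b, |v y|) + ⨆ y : Icc a b, |derivWithin v (Icc a b) y|

end

/-!
Write `u = (u₁, u₂)`. By incompressibility
`u₁ ∇u₂ - u₂ ∇u₁ = (u · ∇u₂, -u · ∇u₁) = (-∂_y P, ∂ₓ P)`, which is divergence-free
(`integral_vorticity_eq_zero`). Where `u₁ ≠ 0` this field is `u₁² ∇h` for the quotient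
`h = u₂ / u₁`, so `h` solves the elliptic equation `div (u₁² ∇h) = 0`, and `h = 0` on the walls
because `u` is tangential. Testing with `h` gives `∫ u₁² |∇h|² = 0` over a period, hence
`u₁ ∇u₂ - u₂ ∇u₁ = 0` (`WindowFlow.ae_W_eq_zero`). Tangency tested with `y u₂` then leaves
`∫ u₂² = 0` (`WindowFlow.ae_V_eq_zero`), and tangency tested with arbitrary functions
becomes `∂ₓ u₁ = 0`, so that `u₁` is a function of `y` (`isShearFlow_of_snd_ae_eq_zero`).

The smallness assumption enters only through the embedding of `W^{1,p}` into `L^∞` for `p > 2`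
(`exists_sup_const`, from Morrey's inequality `exists_morrey_const`): it keeps `u₁` away from zero
and `u` bounded. In particular `ε` depends on `m` but not on `K`.

All regularity is weak, so the test functions are built by mollification. The energy identity
requires `ζ u₂ / u₁` as a test function, where `u₂` vanishes on the walls only in the weak sense
and `u₁` has no extension beyond them. The function `ζ` is therefore localized near one wall at a
time, and `u₂` is mollified with an off-centre kernel that moves its support off that wall
(`WindowFlow.energy_identity_of_cutoff`). Integrals over a period are integrals over the plane
against the cutoff `periodCutoff`, whose translates sum to a constant.
-/

section ChannelFlow

open Filter Topology

/-! ### Mollification -/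

/-- `k` is a smooth probability density supported in the closed ball with centre `c` and
radius `δ` (for the sup norm of `ℝ × ℝ`). The centre need not be `0`: convolution with such a `k`
smooths and at the same time translates by about `c`. -/
structure IsMollifier (k : ℝ × ℝ → ℝ) (c : ℝ × ℝ) (δ : ℝ) : Prop where
  smooth : ContDiff ℝ ∞ k
  nonneg : ∀ z, 0 ≤ k z
  integral_eq_one : ∫ z, k z = 1
  eq_zero : ∀ z, z ∉ Metric.closedBall c δ → k z = 0

/-- The convolution `F * k`. -/
noncomputable def mollify (k F : ℝ × ℝ → ℝ) (z : ℝ × ℝ) : ℝ := ∫ s, F s * k (z - s)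

/-- `G` is the weak derivative of `F` in the direction `e` on the open set `U`; both functions
are defined on the whole plane, and nothing links them outside `U`. -/
structure HasWeakDeriv (U : Set (ℝ × ℝ)) (e : ℝ × ℝ) (F G : ℝ × ℝ → ℝ) : Prop where
  locInt : LocallyIntegrable F
  locInt_deriv : LocallyIntegrable G
  weak : ∀ φ, IsTestFunction U φ → ∫ z, F z * fderiv ℝ φ z e = -∫ z, G z * φ z

theorem exists_isMollifier (c : ℝ × ℝ) {δ : ℝ} (hδ : 0 < δ) :
    ∃ k, IsMollifier k c δ := by
  let φ : ContDiffBump c := ⟨δ / 2, δ, by positivity, by linarith⟩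
  refine ⟨φ.normed volume, φ.contDiff_normed, fun z => φ.nonneg_normed z, φ.integral_normed,
    fun z hz => ?_⟩
  have : z ∉ Function.support (φ.normed volume) := by
    rw [φ.support_normed_eq]
    exact fun h => hz (Metric.ball_subset_closedBall h)
  simpa using this

namespace IsMollifier

variable {k : ℝ × ℝ → ℝ} {c : ℝ × ℝ} {δ : ℝ}

theorem hasCompactSupport (hk : IsMollifier k c δ) : HasCompactSupport k :=
  HasCompactSupport.intro (isCompact_closedBall c δ) hk.eq_zero

theorem integral_sub (hk : IsMollifier k c δ) (z : ℝ × ℝ) : ∫ s, k (z - s) = 1 := by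
  rw [integral_sub_left_eq_self k volume z, hk.integral_eq_one]

theorem integrable (hk : IsMollifier k c δ) : Integrable k :=
  hk.smooth.continuous.integrable_of_hasCompactSupport hk.hasCompactSupport

theorem eq_zero_of_notMem (hk : IsMollifier k c δ) {z s : ℝ × ℝ}
    (hs : s ∉ Metric.closedBall (z - c) δ) : k (z - s) = 0 := by
  refine hk.eq_zero _ fun h => hs ?_
  rw [mem_closedBall_iff_norm] at h ⊢
  rw [← norm_neg]
  have h2 : -(s - (z - c)) = z - s - c := by abel
  rwa [h2]

/-- The reflected and translated kernel `s ↦ k (z - s)`, whose integral against `F` is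
`mollify k F z`, is a test function. -/
theorem isTestFunction_sub (hk : IsMollifier k c δ) {U : Set (ℝ × ℝ)} {z : ℝ × ℝ}
    (hz : Metric.closedBall (z - c) δ ⊆ U) : IsTestFunction U (fun s => k (z - s)) := by
  have hsub : tsupport (fun s => k (z - s)) ⊆ Metric.closedBall (z - c) δ :=
    closure_minimal (fun s hs => by
      by_contra h
      exact hs (hk.eq_zero_of_notMem h)) Metric.isClosed_closedBall
  refine ⟨hk.smooth.comp (contDiff_const.sub contDiff_id), ?_, hsub.trans hz⟩
  exact (isCompact_closedBall _ _).of_isClosed_subset (isClosed_tsupport _) hsub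

theorem integrable_mul (hk : IsMollifier k c δ) {F : ℝ × ℝ → ℝ} (hF : LocallyIntegrable F)
    (z : ℝ × ℝ) : Integrable (fun s => F s * k (z - s)) := by
  have h := hk.isTestFunction_sub (subset_univ (Metric.closedBall (z - c) δ))
  simpa [mul_comm] using
    hF.integrable_smul_left_of_hasCompactSupport h.smooth.continuous h.compact

theorem contDiff_mollify (hk : IsMollifier k c δ) {F : ℝ × ℝ → ℝ} (hF : LocallyIntegrable F) :
    ContDiff ℝ ∞ (mollify k F) :=
  hk.hasCompactSupport.contDiff_convolution_right (ContinuousLinearMap.lsmul ℝ ℝ) hF hk.smooth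

/-- Mollification commutes with weak differentiation at points whose mollification ball lies in
the set where the weak derivative lives. -/
theorem fderiv_mollify (hk : IsMollifier k c δ) {U : Set (ℝ × ℝ)} {e : ℝ × ℝ}
    {F G : ℝ × ℝ → ℝ} (h : HasWeakDeriv U e F G) {z : ℝ × ℝ}
    (hz : Metric.closedBall (z - c) δ ⊆ U) :
    fderiv ℝ (mollify k F) z e = mollify k G z := by
  have hd := hk.hasCompactSupport.hasFDerivAt_convolution_right (ContinuousLinearMap.lsmul ℝ ℝ)
    h.locInt (hk.smooth.of_le (by simp)) z
  have hd' : HasFDerivAt (mollify k F) _ z := hd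
  rw [hd'.fderiv, convolution_precompR_apply]
  rotate_left
  · exact h.locInt
  · exact hk.hasCompactSupport.fderiv (𝕜 := ℝ)
  · exact hk.smooth.continuous_fderiv (by simp)
  have ht := h.weak _ (hk.isTestFunction_sub hz)
  have hfd : ∀ s, fderiv ℝ (fun s => k (z - s)) s e = -(fderiv ℝ k (z - s) e) := by
    intro s
    have h1 : HasFDerivAt (fun s => k (z - s))
        ((fderiv ℝ k (z - s)).comp (-ContinuousLinearMap.id ℝ (ℝ × ℝ))) s :=
      HasFDerivAt.comp s ((hk.smooth.differentiable (by simp) (z - s)).hasFDerivAt)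
        ((hasFDerivAt_id s).const_sub z)
    rw [h1.fderiv]
    simp
  simp only [hfd, mul_neg, integral_neg, neg_inj] at ht
  simpa [convolution_def, mollify] using ht

theorem le_mollify (hk : IsMollifier k c δ) {F : ℝ × ℝ → ℝ} (hF : LocallyIntegrable F)
    {z : ℝ × ℝ} {C : ℝ} (h : ∀ᵐ s, s ∈ Metric.closedBall (z - c) δ → C ≤ F s) :
    C ≤ mollify k F z := by
  have h1 : ∫ s, C * k (z - s) = C := by rw [integral_const_mul, hk.integral_sub, mul_one]
  rw [← h1, mollify]
  have hi : Integrable fun s => C * k (z - s) := (hk.integrable.comp_sub_left z).const_mul C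
  refine integral_mono_ae hi (hk.integrable_mul hF z) ?_
  filter_upwards [h] with s hs
  by_cases hmem : s ∈ Metric.closedBall (z - c) δ
  · exact mul_le_mul_of_nonneg_right (hs hmem) (hk.nonneg _)
  · simp [hk.eq_zero_of_notMem hmem]

theorem mollify_const_mul (k F : ℝ × ℝ → ℝ) (σ : ℝ) (z : ℝ × ℝ) :
    mollify k (fun s => σ * F s) z = σ * mollify k F z := by
  simp [mollify, mul_assoc, integral_const_mul]

theorem mollify_le (hk : IsMollifier k c δ) {F : ℝ × ℝ → ℝ} (hF : LocallyIntegrable F)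
    {z : ℝ × ℝ} {C : ℝ} (h : ∀ᵐ s, s ∈ Metric.closedBall (z - c) δ → F s ≤ C) :
    mollify k F z ≤ C := by
  have h1 := hk.le_mollify (F := fun s => (-1) * F s) (C := -C) (z := z) (hF.smul (-1 : ℝ)) (by
    filter_upwards [h] with s hs hmem
    have := hs hmem
    linarith)
  rw [mollify_const_mul] at h1
  linarith

theorem abs_mollify_le (hk : IsMollifier k c δ) {F : ℝ × ℝ → ℝ} (hF : LocallyIntegrable F)
    {C : ℝ} (h : ∀ᵐ s, |F s| ≤ C) (z : ℝ × ℝ) : |mollify k F z| ≤ C := by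
  rw [abs_le]
  constructor
  · exact hk.le_mollify hF (h.mono fun s hs _ => (abs_le.1 hs).1)
  · exact hk.mollify_le hF (h.mono fun s hs _ => (abs_le.1 hs).2)

theorem mollify_eq_zero (hk : IsMollifier k c δ) {F : ℝ × ℝ → ℝ} {z : ℝ × ℝ}
    (h : ∀ s ∈ Metric.closedBall (z - c) δ, F s = 0) : mollify k F z = 0 := by
  rw [mollify, integral_eq_zero_of_ae]
  filter_upwards with s
  by_cases hmem : s ∈ Metric.closedBall (z - c) δ
  · simp [h s hmem]
  · simp [hk.eq_zero_of_notMem hmem]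

theorem mollify_sub (hk : IsMollifier k c δ) {F G : ℝ × ℝ → ℝ} (hF : LocallyIntegrable F)
    (hG : LocallyIntegrable G) : mollify k (F - G) = mollify k F - mollify k G := by
  funext z
  simp only [mollify, Pi.sub_apply, sub_mul]
  exact MeasureTheory.integral_sub (hk.integrable_mul hF z) (hk.integrable_mul hG z)

/-- Convolution with a probability density is a contraction of `L^q`: Jensen's inequality for
the density, then Tonelli's theorem. -/
theorem lintegral_mollify_le (hk : IsMollifier k c δ) {F : ℝ × ℝ → ℝ}
    (hF : AEStronglyMeasurable F) {q : ℝ} (hq : 1 ≤ q) :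
    ∫⁻ z, ‖mollify k F z‖ₑ ^ q ≤ ∫⁻ z, ‖F z‖ₑ ^ q := by
  set κ : ℝ × ℝ → ℝ≥0∞ := fun z => ENNReal.ofReal (k z) with hκ
  have hκm : Measurable κ := hk.smooth.continuous.measurable.ennreal_ofReal
  set ν := (volume : Measure (ℝ × ℝ)).withDensity κ with hν
  have hκ1 : ∫⁻ z, κ z = 1 := by
    rw [← ofReal_integral_eq_lintegral_ofReal hk.integrable
      (Filter.Eventually.of_forall hk.nonneg), hk.integral_eq_one, ENNReal.ofReal_one]
  have hνp : IsProbabilityMeasure ν := ⟨by simp [hν, hκ1]⟩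
  have hac : ν ≪ volume := withDensity_absolutelyContinuous _ _
  have hmeas : ∀ z, AEStronglyMeasurable (fun t => F (z - t)) volume := fun z =>
    hF.comp_quasiMeasurePreserving (quasiMeasurePreserving_sub_left volume z)
  have hpt : ∀ z, ‖mollify k F z‖ₑ ^ q ≤ ∫⁻ t, ‖F (z - t)‖ₑ ^ q ∂ν := by
    intro z
    have h1 : ‖mollify k F z‖ₑ ≤ ∫⁻ t, ‖F (z - t)‖ₑ ∂ν := by
      have h2 : mollify k F z = ∫ t, F (z - t) * k t := by
        rw [mollify, ← integral_sub_left_eq_self _ volume z]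
        simp
      rw [h2, hν, lintegral_withDensity_eq_lintegral_mul₀ hκm.aemeasurable (hmeas z).enorm]
      refine (enorm_integral_le_lintegral_enorm _).trans (lintegral_mono fun t => ?_)
      simp only [Pi.mul_apply, hκ, enorm_mul, Real.enorm_of_nonneg (hk.nonneg t)]
      rw [mul_comm]
    have h3 := eLpNorm'_le_eLpNorm'_of_exponent_le one_pos hq ν ((hmeas z).mono_ac hac)
    simp only [eLpNorm', ENNReal.rpow_one, div_one] at h3
    refine (ENNReal.rpow_le_rpow (h1.trans h3) (by linarith)).trans (le_of_eq ?_)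
    rw [← ENNReal.rpow_mul, one_div, inv_mul_cancel₀ (by linarith), ENNReal.rpow_one]
  refine (lintegral_mono hpt).trans (le_of_eq ?_)
  have hjoint : AEMeasurable (fun p : (ℝ × ℝ) × (ℝ × ℝ) => ‖F (p.1 - p.2)‖ₑ ^ q)
      (volume.prod ν) := by
    have : AEStronglyMeasurable (fun p : (ℝ × ℝ) × (ℝ × ℝ) => F (p.1 - p.2))
        (volume.prod volume) :=
      hF.comp_quasiMeasurePreserving (quasiMeasurePreserving_sub volume volume)
    have h' := this.mono_ac (Measure.AbsolutelyContinuous.prod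
      (Measure.AbsolutelyContinuous.refl (volume : Measure (ℝ × ℝ))) hac)
    exact h'.enorm.pow_const q
  rw [lintegral_lintegral_swap hjoint]
  simp_rw [lintegral_sub_right_eq_self (fun z => ‖F z‖ₑ ^ q)]
  simp

theorem eLpNorm_mollify_le (hk : IsMollifier k c δ) {F : ℝ × ℝ → ℝ}
    (hF : AEStronglyMeasurable F) {q : ℝ≥0∞} (hq : 1 ≤ q) (hq' : q ≠ ⊤) :
    eLpNorm (mollify k F) q volume ≤ eLpNorm F q volume := by
  have h0 : q ≠ 0 := by rintro rfl; simp at hq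
  rw [eLpNorm_eq_lintegral_rpow_enorm_toReal h0 hq', eLpNorm_eq_lintegral_rpow_enorm_toReal h0 hq']
  have h1 : 1 ≤ q.toReal := by
    have := ENNReal.toReal_mono hq' hq
    simpa using this
  exact ENNReal.rpow_le_rpow (hk.lintegral_mollify_le hF h1) (by positivity)

/-- For a continuous compactly supported `g`, mollification with kernels shrinking to the origin
converges in every `L^q`: it converges uniformly, and the supports stay in a fixed compact set. -/
theorem tendsto_eLpNorm_mollify_sub_of_continuous {k : ℕ → ℝ × ℝ → ℝ} {c : ℕ → ℝ × ℝ} {δ : ℕ → ℝ}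
    (hk : ∀ n, IsMollifier (k n) (c n) (δ n)) (hc : Tendsto c atTop (𝓝 0))
    (hδ : Tendsto δ atTop (𝓝 0)) {g : ℝ × ℝ → ℝ} (hg : Continuous g) (hgc : HasCompactSupport g)
    (q : ℝ≥0∞) :
    Tendsto (fun n => eLpNorm (mollify (k n) g - g) q volume) atTop (𝓝 0) := by
  have hgl : LocallyIntegrable g := hg.locallyIntegrable
  set S := Metric.cthickening 1 (tsupport g) with hS
  have hScomp : IsCompact S := hgc.cthickening
  have hvol : (volume S) ^ (q.toReal)⁻¹ ≠ ⊤ :=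
    ENNReal.rpow_ne_top_of_nonneg (by positivity) hScomp.measure_lt_top.ne
  have huc : UniformContinuous g := hgc.uniformContinuous_of_continuous hg
  have key : ∀ ε > 0, ∀ᶠ n in atTop,
      eLpNorm (mollify (k n) g - g) q volume ≤ (volume S) ^ (q.toReal)⁻¹ * ENNReal.ofReal ε := by
    intro ε hε
    obtain ⟨η, hη, hηg⟩ := Metric.uniformContinuous_iff.1 huc ε hε
    have h1 : ∀ᶠ n in atTop, ‖c n‖ + δ n < min η 1 := by
      have : Tendsto (fun n => ‖c n‖ + δ n) atTop (𝓝 0) := by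
        simpa using hc.norm.add hδ
      exact this.eventually (gt_mem_nhds (by positivity))
    filter_upwards [h1] with n hn
    have hdist : ∀ z s, s ∈ Metric.closedBall (z - c n) (δ n) → dist s z < min η 1 := by
      intro z s hs
      have h2 : dist (z - c n) z = ‖c n‖ := by simp
      linarith [dist_triangle s (z - c n) z, Metric.mem_closedBall.1 hs]
    have hsupp : ∀ z, z ∉ S → (mollify (k n) g - g) z = 0 := by
      intro z hz
      have hfar : ∀ s, dist s z < min η 1 → g s = 0 := by
        intro s hs
        by_contra hne
        refine hz (Metric.mem_cthickening_of_dist_le z s 1 _ (subset_tsupport g hne) ?_)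
        rw [dist_comm]
        exact hs.le.trans (min_le_right _ _)
      simp [(hk n).mollify_eq_zero fun s hs => hfar s (hdist z s hs),
        hfar z (by simpa using hη)]
    have hbound : ∀ z, ‖(mollify (k n) g - g) z‖ ≤ ε := by
      intro z
      have hclose : ∀ s ∈ Metric.closedBall (z - c n) (δ n), |g s - g z| ≤ ε := fun s hs =>
        (hηg ((hdist z s hs).trans_le (min_le_left _ _))).le
      have h3 := (hk n).le_mollify hgl (z := z) (C := g z - ε)
        (ae_of_all _ fun s hs => by linarith [(abs_le.1 (hclose s hs)).1])
      have h4 := (hk n).mollify_le hgl (z := z) (C := g z + ε)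
        (ae_of_all _ fun s hs => by linarith [(abs_le.1 (hclose s hs)).2])
      rw [Real.norm_eq_abs, Pi.sub_apply, abs_le]
      constructor <;> linarith
    have h5 : eLpNorm (mollify (k n) g - g) q volume
        = eLpNorm (mollify (k n) g - g) q (volume.restrict S) := by
      refine (eLpNorm_restrict_eq_of_support_subset fun z hz => ?_).symm
      by_contra h
      exact hz (hsupp z h)
    rw [h5]
    refine (eLpNorm_le_of_ae_bound (ae_of_all _ hbound)).trans ?_
    simp
  rw [ENNReal.tendsto_nhds_zero]
  intro ε hε
  rcases eq_or_ne ε ⊤ with rfl | hεt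
  · exact Eventually.of_forall fun n => le_top
  set V := (volume S) ^ (q.toReal)⁻¹ with hV
  have hpos : 0 < ε.toReal / (V.toReal + 1) := by
    have := ENNReal.toReal_pos hε.ne' hεt
    positivity
  filter_upwards [key _ hpos] with n hn
  refine hn.trans ?_
  have h6 : V = ENNReal.ofReal V.toReal := (ENNReal.ofReal_toReal hvol).symm
  rw [h6, ← ENNReal.ofReal_mul ENNReal.toReal_nonneg]
  refine ENNReal.ofReal_le_of_le_toReal ?_
  rw [ENNReal.toReal_ofReal ENNReal.toReal_nonneg, ← mul_div_assoc,
    div_le_iff₀ (by positivity), mul_comm]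
  have := ENNReal.toReal_pos hε.ne' hεt
  nlinarith [ENNReal.toReal_nonneg (a := V)]

/-- Mollification with kernels shrinking to the origin converges in `L^q`, by contractivity and
density of continuous functions of compact support. -/
theorem tendsto_eLpNorm_mollify_sub {k : ℕ → ℝ × ℝ → ℝ} {c : ℕ → ℝ × ℝ} {δ : ℕ → ℝ}
    (hk : ∀ n, IsMollifier (k n) (c n) (δ n)) (hc : Tendsto c atTop (𝓝 0))
    (hδ : Tendsto δ atTop (𝓝 0)) {q : ℝ≥0∞} (hq : 1 ≤ q) (hq' : q ≠ ⊤) {F : ℝ × ℝ → ℝ}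
    (hF : MemLp F q volume) :
    Tendsto (fun n => eLpNorm (mollify (k n) F - F) q volume) atTop (𝓝 0) := by
  rw [ENNReal.tendsto_nhds_zero]
  intro ε hε
  have hε3 : ε / 3 ≠ 0 := by simp [hε.ne']
  obtain ⟨g, hgc, hgF, hg, hgm⟩ := hF.exists_hasCompactSupport_eLpNorm_sub_le hq' hε3
  have hgl : LocallyIntegrable g := hg.locallyIntegrable
  have hFl : LocallyIntegrable F := hF.locallyIntegrable hq
  filter_upwards [(ENNReal.tendsto_nhds_zero.1 (tendsto_eLpNorm_mollify_sub_of_continuous hk hc hδ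
    hg hgc q)) (ε / 3) (pos_iff_ne_zero.2 hε3)] with n hn
  have hsm : ∀ {H}, LocallyIntegrable H → AEStronglyMeasurable (mollify (k n) H) volume :=
    fun hH => ((hk n).contDiff_mollify hH).continuous.aestronglyMeasurable
  have hdec : mollify (k n) F - F
      = mollify (k n) (F - g) + (mollify (k n) g - g) + -(F - g) := by
    rw [(hk n).mollify_sub hFl hgl]
    abel
  rw [hdec]
  have hm1 : AEStronglyMeasurable (F - g) volume := hF.1.sub hgm.1
  calc _ ≤ eLpNorm (mollify (k n) (F - g)) q volume + eLpNorm (mollify (k n) g - g) q volume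
        + eLpNorm (-(F - g)) q volume := by
        refine (eLpNorm_add_le (((hsm (hFl.sub hgl))).add ((hsm hgl).sub hgm.1)) hm1.neg hq).trans ?_
        gcongr
        exact eLpNorm_add_le (hsm (hFl.sub hgl)) ((hsm hgl).sub hgm.1) hq
    _ ≤ ε / 3 + ε / 3 + ε / 3 := by
        rw [eLpNorm_neg]
        gcongr
        exact ((hk n).eLpNorm_mollify_le hm1 hq hq').trans hgF
    _ = ε := ENNReal.add_thirds ε

end IsMollifier

/-! ### Morrey's inequality -/

/-- The homothety with centre `z` and ratio `t` maps the ball into itself, and it contracts area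
by `t²`. -/
theorem setLIntegral_comp_homothety_le {H : ℝ × ℝ → ℝ≥0∞} (hH : Measurable H) {c z : ℝ × ℝ} {r : ℝ}
    (hz : z ∈ Metric.ball c r) {t : ℝ} (ht : t ∈ Ioo (0 : ℝ) 1) :
    ∫⁻ w in Metric.ball c r, H (z + t • (w - z))
      ≤ ENNReal.ofReal (t ^ (-2 : ℝ)) * ∫⁻ w in Metric.ball c r, H w := by
  set B := Metric.ball c r
  have hB : MeasurableSet B := measurableSet_ball
  have hJ : Measurable (B.indicator H) := hH.indicator hB
  have h1 : ∫⁻ w in B, H (z + t • (w - z)) ≤ ∫⁻ w, B.indicator H (z + t • (w - z)) := by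
    rw [← lintegral_indicator hB]
    refine lintegral_mono fun w => ?_
    by_cases hw : w ∈ B
    · have : z + t • (w - z) ∈ B :=
        (convex_ball c r).add_smul_sub_mem hz hw ⟨ht.1.le, ht.2.le⟩
      simp [hw, this]
    · simp [hw]
  refine h1.trans (le_of_eq ?_)
  have h2 : ∫⁻ w, B.indicator H (z + t • (w - z)) = ∫⁻ w, B.indicator H (t • w) := by
    rw [← lintegral_sub_right_eq_self (fun w => B.indicator H (t • w)) (z - t⁻¹ • z)]
    refine lintegral_congr fun w => ?_
    congr 1
    simp only [smul_sub, smul_smul, mul_inv_cancel₀ ht.1.ne', one_smul]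
    abel
  rw [h2, ← lintegral_map (f := B.indicator H) hJ (measurable_const_smul t),
    Measure.map_addHaar_smul volume ht.1.ne', lintegral_smul_measure, lintegral_indicator hB]
  have h3 : |(t ^ Module.finrank ℝ (ℝ × ℝ))⁻¹| = t ^ (-2 : ℝ) := by
    rw [abs_of_pos (by have := ht.1; positivity), Real.rpow_neg ht.1.le]
    simp
  rw [h3, smul_eq_mul]

theorem setLIntegral_le_rpow_mul_measure {H : ℝ × ℝ → ℝ≥0∞} (hH : Measurable H)
    (B : Set (ℝ × ℝ)) {q : ℝ} (hq : 1 < q) :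
    ∫⁻ w in B, H w ≤ (∫⁻ w in B, H w ^ q) ^ (1 / q) * volume B ^ (1 - 1 / q) := by
  have h := ENNReal.lintegral_mul_le_Lp_mul_Lq (volume.restrict B)
    (Real.HolderConjugate.conjExponent hq) hH.aemeasurable (g := fun _ => 1) aemeasurable_const
  have h2 : 1 / Real.conjExponent q = 1 - 1 / q := by
    have := (Real.HolderConjugate.conjExponent hq).inv_add_inv_eq_one
    simp only [one_div]
    linarith
  rw [h2] at h
  simpa using h

theorem enorm_sub_le_lintegral_fderiv {f : ℝ × ℝ → ℝ} (hf : ContDiff ℝ 1 f) {c z w : ℝ × ℝ} {r : ℝ}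
    (hz : z ∈ Metric.ball c r) (hw : w ∈ Metric.ball c r) :
    ‖f z - f w‖ₑ
      ≤ ∫⁻ t in Ioo (0 : ℝ) 1, ENNReal.ofReal (2 * r) * ‖fderiv ℝ f (z + t • (w - z))‖ₑ := by
  have hd : ∀ t ∈ uIcc (0 : ℝ) 1, HasDerivAt (fun t : ℝ => f (z + t • (w - z)))
      (fderiv ℝ f (z + t • (w - z)) (w - z)) t := by
    intro t _
    have h1 : HasDerivAt (fun t : ℝ => z + t • (w - z)) (w - z) t := by
      simpa using ((hasDerivAt_id t).smul_const (w - z)).const_add z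
    exact ((hf.differentiable (by simp) _).hasFDerivAt).comp_hasDerivAt t h1
  have hc : Continuous fun t : ℝ => fderiv ℝ f (z + t • (w - z)) (w - z) :=
    ((hf.continuous_fderiv (by simp)).comp (by fun_prop)).clm_apply continuous_const
  have h2 := intervalIntegral.integral_eq_sub_of_hasDerivAt hd (hc.intervalIntegrable 0 1)
  simp only [one_smul, zero_smul, add_zero, add_sub_cancel] at h2
  rw [← neg_sub (f w) (f z), enorm_neg, ← h2, intervalIntegral.integral_of_le zero_le_one,
    integral_Ioc_eq_integral_Ioo]
  refine (enorm_integral_le_lintegral_enorm _).trans (lintegral_mono fun t => ?_)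
  refine (ContinuousLinearMap.le_opENorm _ _).trans ?_
  rw [mul_comm]
  gcongr
  rw [← ofReal_norm]
  refine ENNReal.ofReal_le_ofReal ?_
  rw [← dist_eq_norm]
  have := Metric.mem_ball.1 hz
  have := Metric.mem_ball.1 hw
  linarith [dist_triangle_right w z c]

/-- **Morrey's inequality** on a ball, with a constant that does not depend on the centre.
The mean of `|f z - f w|` over `w` in the ball is bounded by integrating the gradient along the
segments from `z`; after Hölder's inequality the homothety of ratio `t` contributes the factor
`t ^ (-2/q)`, which is integrable at `0` because `q > 2`. -/
theorem exists_morrey_const {r q : ℝ} (hr : 0 < r) (hq : 2 < q) :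
    ∃ C : ℝ≥0∞, C ≠ ⊤ ∧ ∀ (f : ℝ × ℝ → ℝ) (c z : ℝ × ℝ), ContDiff ℝ 1 f → z ∈ Metric.ball c r →
      ‖f z‖ₑ ≤ C * ((∫⁻ w in Metric.ball c r, ‖f w‖ₑ ^ q) ^ (1 / q)
        + (∫⁻ w in Metric.ball c r, ‖fderiv ℝ f w‖ₑ ^ q) ^ (1 / q)) := by
  set V : ℝ≥0∞ := volume (Metric.ball (0 : ℝ × ℝ) r) with hV
  have hV0 : V ≠ 0 := (Metric.measure_ball_pos _ _ hr).ne'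
  have hVt : V ≠ ⊤ := measure_ball_lt_top.ne
  have hVc : ∀ c : ℝ × ℝ, volume (Metric.ball c r) = V := fun c =>
    Measure.addHaar_ball_center volume c r
  set K : ℝ≥0∞ := ∫⁻ t in Ioo (0 : ℝ) 1, ENNReal.ofReal (t ^ (-2 / q)) with hK
  have hKt : K ≠ ⊤ := by
    have hint : IntegrableOn (fun t : ℝ => t ^ (-2 / q)) (Ioo 0 1) := by
      rw [intervalIntegral.integrableOn_Ioo_rpow_iff one_pos, lt_div_iff₀ (by linarith)]
      linarith
    exact hint.lintegral_lt_top.ne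
  set Vq : ℝ≥0∞ := V ^ (1 - 1 / q) with hVq
  have hq1 : 0 ≤ 1 - 1 / q := by
    rw [sub_nonneg, div_le_one (by linarith)]
    linarith
  have hVqt : Vq ≠ ⊤ := ENNReal.rpow_ne_top_of_nonneg hq1 hVt
  refine ⟨V⁻¹ * (Vq * (1 + ENNReal.ofReal (2 * r) * K)), ?_, fun f c z hf hz => ?_⟩
  · exact ENNReal.mul_ne_top (ENNReal.inv_ne_top.2 hV0) (ENNReal.mul_ne_top hVqt
      (ENNReal.add_ne_top.2 ⟨ENNReal.one_ne_top, ENNReal.mul_ne_top ENNReal.ofReal_ne_top hKt⟩))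
  set B := Metric.ball c r with hB
  have hN : Measurable fun w => ‖fderiv ℝ f w‖ₑ :=
    ((hf.continuous_fderiv (by simp)).enorm).measurable
  have hfm : Measurable fun w => ‖f w‖ₑ := hf.continuous.enorm.measurable
  set A : ℝ≥0∞ := (∫⁻ w in B, ‖fderiv ℝ f w‖ₑ ^ q) ^ (1 / q) with hA
  have hslice : ∀ t ∈ Ioo (0 : ℝ) 1,
      ∫⁻ w in B, ‖fderiv ℝ f (z + t • (w - z))‖ₑ ≤ ENNReal.ofReal (t ^ (-2 / q)) * (A * Vq) := by
    intro t ht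
    refine (setLIntegral_le_rpow_mul_measure (H := fun w => ‖fderiv ℝ f (z + t • (w - z))‖ₑ)
      (hN.comp (by fun_prop)) B (by linarith : 1 < q)).trans ?_
    rw [hVc c, ← mul_assoc]
    refine mul_le_mul_left ?_ _
    refine (ENNReal.rpow_le_rpow (setLIntegral_comp_homothety_le (hN.pow_const q) hz ht)
      (by positivity)).trans (le_of_eq ?_)
    rw [ENNReal.mul_rpow_of_nonneg _ _ (by positivity), ENNReal.ofReal_rpow_of_nonneg
      (Real.rpow_nonneg ht.1.le _) (by positivity), ← Real.rpow_mul ht.1.le, mul_one_div]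
  have hmain : V * ‖f z‖ₑ ≤ Vq * (1 + ENNReal.ofReal (2 * r) * K) *
      ((∫⁻ w in B, ‖f w‖ₑ ^ q) ^ (1 / q) + A) := by
    calc V * ‖f z‖ₑ = ∫⁻ _ in B, ‖f z‖ₑ := by simp [hVc, mul_comm, hB]
      _ ≤ ∫⁻ w in B, (‖f w‖ₑ
          + ∫⁻ t in Ioo (0 : ℝ) 1, ENNReal.ofReal (2 * r) * ‖fderiv ℝ f (z + t • (w - z))‖ₑ) := by
          refine setLIntegral_mono' measurableSet_ball fun w hw => ?_
          calc ‖f z‖ₑ = ‖f w + (f z - f w)‖ₑ := by simp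
            _ ≤ ‖f w‖ₑ + ‖f z - f w‖ₑ := enorm_add_le _ _
            _ ≤ _ := by gcongr; exact enorm_sub_le_lintegral_fderiv hf hz hw
      _ = (∫⁻ w in B, ‖f w‖ₑ) + ∫⁻ t in Ioo (0 : ℝ) 1,
          ENNReal.ofReal (2 * r) * ∫⁻ w in B, ‖fderiv ℝ f (z + t • (w - z))‖ₑ := by
          rw [lintegral_add_left hfm, lintegral_lintegral_swap]
          · congr 1
            refine lintegral_congr fun t => ?_
            rw [lintegral_const_mul]
            exact hN.comp (by fun_prop)
          · refine Measurable.aemeasurable ?_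
            refine Measurable.const_mul ?_ _
            exact hN.comp (by fun_prop)
      _ ≤ (∫⁻ w in B, ‖f w‖ₑ ^ q) ^ (1 / q) * Vq + ∫⁻ t in Ioo (0 : ℝ) 1,
          ENNReal.ofReal (2 * r) * (ENNReal.ofReal (t ^ (-2 / q)) * (A * Vq)) := by
          gcongr ?_ + ?_
          · have := setLIntegral_le_rpow_mul_measure hfm B (by linarith : 1 < q)
            rwa [hVc c] at this
          · refine setLIntegral_mono' measurableSet_Ioo fun t ht => ?_
            gcongr
            exact hslice t ht
      _ = (∫⁻ w in B, ‖f w‖ₑ ^ q) ^ (1 / q) * Vq + ENNReal.ofReal (2 * r) * (K * (A * Vq)) := by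
          have hm : Measurable fun t : ℝ => ENNReal.ofReal (t ^ (-2 / q)) := by fun_prop
          rw [lintegral_const_mul _ (hm.mul_const _), lintegral_mul_const _ hm]
      _ ≤ _ := by
          set X := (∫⁻ w in B, ‖f w‖ₑ ^ q) ^ (1 / q)
          have : Vq * (1 + ENNReal.ofReal (2 * r) * K) * (X + A)
              = (X * Vq + ENNReal.ofReal (2 * r) * (K * (A * Vq)))
                + (Vq * A + Vq * (ENNReal.ofReal (2 * r) * K) * X) := by ring
          rw [this]
          exact le_self_add
  rw [mul_assoc, ← ENNReal.mul_le_iff_le_inv hV0 hVt]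
  exact hmain

/-! ### Test functions -/

namespace IsTestFunction

variable {U V : Set (ℝ × ℝ)} {φ ψ : ℝ × ℝ → ℝ}

theorem eq_zero_of_notMem (h : IsTestFunction U φ) {z : ℝ × ℝ} (hz : z ∉ U) : φ z = 0 :=
  image_eq_zero_of_notMem_tsupport fun hmem => hz (h.support hmem)

theorem mono (h : IsTestFunction U φ) (hUV : U ⊆ V) : IsTestFunction V φ :=
  ⟨h.smooth, h.compact, h.support.trans hUV⟩

theorem fderiv_apply (h : IsTestFunction U φ) (e : ℝ × ℝ) :
    IsTestFunction U (fun z => fderiv ℝ φ z e) :=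
  ⟨(h.smooth.fderiv_right (m := ∞) (by simp)).clm_apply contDiff_const,
    h.compact.fderiv_apply (𝕜 := ℝ) e, (tsupport_fderiv_apply_subset ℝ e).trans h.support⟩

theorem mul_left (h : IsTestFunction U φ) (hψ : ContDiff ℝ ∞ ψ) :
    IsTestFunction U (fun z => ψ z * φ z) :=
  ⟨hψ.mul h.smooth, h.compact.mul_left, (tsupport_mul_subset_right).trans h.support⟩

theorem continuous (h : IsTestFunction U φ) : Continuous φ := h.smooth.continuous

theorem comp_add_right (h : IsTestFunction U φ) (s : ℝ × ℝ) (hV : ∀ z, z + s ∈ U → z ∈ V) :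
    IsTestFunction V (fun z => φ (z + s)) := by
  refine ⟨h.smooth.comp (by fun_prop), h.compact.comp_homeomorph (Homeomorph.addRight s), ?_⟩
  intro z hz
  have : tsupport (fun z => φ (z + s)) = (Homeomorph.addRight s) ⁻¹' tsupport φ :=
    tsupport_comp_eq_preimage φ (Homeomorph.addRight s)
  rw [this] at hz
  exact hV z (h.support hz)

theorem integrable_mul (h : IsTestFunction U φ) {f : ℝ × ℝ → ℝ} (hf : LocallyIntegrable f) :
    Integrable fun z => f z * φ z := by
  simpa [mul_comm] using hf.integrable_smul_left_of_hasCompactSupport h.continuous h.compact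

theorem exists_bound (h : IsTestFunction U φ) : ∃ C, ∀ z, |φ z| ≤ C :=
  h.continuous.bounded_above_of_compact_support h.compact

end IsTestFunction

theorem integral_indicator_mul_eq {S U : Set (ℝ × ℝ)} (hU : MeasurableSet U)
    (hSU : S ⊆ U) (f : ℝ × ℝ → ℝ) {ψ : ℝ × ℝ → ℝ} (hψ : ∀ z ∉ S, ψ z = 0) :
    ∫ z, S.indicator f z * ψ z = ∫ z in U, f z * ψ z := by
  rw [← integral_indicator hU]
  refine integral_congr_ae (ae_of_all _ fun z => ?_)
  by_cases hz : z ∈ S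
  · simp [hz, hSU hz]
  · by_cases hzU : z ∈ U <;> simp [hz, hzU, hψ z hz]

/-! ### Weak gradients on the strip -/

theorem isOpen_strip (a b : ℝ) : IsOpen (strip a b) := isOpen_univ.prod isOpen_Ioo

theorem mem_strip {a b : ℝ} {z : ℝ × ℝ} : z ∈ strip a b ↔ z.2 ∈ Ioo a b := by simp [strip]

namespace HasWeakGradient

variable {U : Set (ℝ × ℝ)} {f f' : ℝ × ℝ → ℝ} {g g' : ℝ × ℝ → ℝ × ℝ}

theorem _root_.MeasureTheory.LocallyIntegrableOn.integrableOn_mul_test {f φ : ℝ × ℝ → ℝ}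
    (hf : LocallyIntegrableOn f U) (hφ : IsTestFunction U φ) :
    IntegrableOn (fun z => f z * φ z) U := by
  have h1 : IntegrableOn f (tsupport φ) :=
    hf.integrableOn_compact_subset hφ.support hφ.compact
  have h2 : IntegrableOn (fun z => f z * φ z) (tsupport φ) :=
    h1.mul_continuousOn hφ.continuous.continuousOn hφ.compact
  exact ((integrableOn_iff_integrable_of_support_subset fun z hz =>
    subset_tsupport φ (right_ne_zero_of_mul hz)).1 h2).integrableOn

/-- Weak gradients are unique almost everywhere. -/
theorem ae_unique (hU : IsOpen U) (h : HasWeakGradient U f g) (h' : HasWeakGradient U f' g')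
    (hff' : ∀ z ∈ U, f z = f' z) : ∀ᵐ z, z ∈ U → g z = g' z := by
  have key : ∀ {G G' : ℝ × ℝ → ℝ}, LocallyIntegrableOn G U → LocallyIntegrableOn G' U →
      (∀ φ, IsTestFunction U φ → ∫ z in U, G z * φ z = ∫ z in U, G' z * φ z) →
      ∀ᵐ z, z ∈ U → G z = G' z := by
    intro G G' hG hG' hint
    have h0 := hU.ae_eq_zero_of_integral_contDiff_smul_eq_zero (μ := volume) (hG.sub hG')
      fun φ hφ hφc hφs => by
        have ht : IsTestFunction U φ := ⟨hφ, hφc, hφs⟩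
        have h1 : ∫ z, φ z • (G - G') z = ∫ z in U, (G z * φ z - G' z * φ z) := by
          rw [← setIntegral_eq_integral_of_forall_compl_eq_zero (s := U) (fun z hz => by
            simp [ht.eq_zero_of_notMem hz])]
          congr 1
          ext z
          simp only [Pi.sub_apply, smul_eq_mul]
          ring
        rw [h1, integral_sub (LocallyIntegrableOn.integrableOn_mul_test hG ht)
          (LocallyIntegrableOn.integrableOn_mul_test hG' ht), hint φ ht, sub_self]
    filter_upwards [h0] with z hz hzU
    exact sub_eq_zero.1 (hz hzU)
  have hcongr : ∀ ψ : ℝ × ℝ → ℝ, ∫ z in U, f z * ψ z = ∫ z in U, f' z * ψ z := fun ψ =>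
    setIntegral_congr_fun hU.measurableSet fun z hz => by simp [hff' z hz]
  have hx := key h.locInt_x h'.locInt_x fun φ hφ => by
    rw [← neg_inj, ← h.weak_x φ hφ, ← h'.weak_x φ hφ, hcongr]
  have hy := key h.locInt_y h'.locInt_y fun φ hφ => by
    rw [← neg_inj, ← h.weak_y φ hφ, ← h'.weak_y φ hφ, hcongr]
  filter_upwards [hx, hy] with z h1 h2 hz
  exact Prod.ext (h1 hz) (h2 hz)

theorem setIntegral_sub_mul {f f' φ : ℝ × ℝ → ℝ}
    (hf : LocallyIntegrableOn f U) (hf' : LocallyIntegrableOn f' U) (hφ : IsTestFunction U φ) :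
    ∫ z in U, (f z - f' z) * φ z = (∫ z in U, f z * φ z) - ∫ z in U, f' z * φ z := by
  rw [← integral_sub (LocallyIntegrableOn.integrableOn_mul_test hf hφ)
    (LocallyIntegrableOn.integrableOn_mul_test hf' hφ)]
  simp only [sub_mul]

theorem sub (h : HasWeakGradient U f g) (h' : HasWeakGradient U f' g') :
    HasWeakGradient U (fun z => f z - f' z) (fun z => g z - g' z) where
  locInt := h.locInt.sub h'.locInt
  locInt_x := h.locInt_x.sub h'.locInt_x
  locInt_y := h.locInt_y.sub h'.locInt_y
  weak_x φ hφ := by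
    have hd : IsTestFunction U (dx φ) := hφ.fderiv_apply (1, 0)
    rw [setIntegral_sub_mul h.locInt h'.locInt hd, h.weak_x φ hφ, h'.weak_x φ hφ]
    have := setIntegral_sub_mul h.locInt_x h'.locInt_x hφ
    simp only [Prod.fst_sub]
    rw [this]
    ring
  weak_y φ hφ := by
    have hd : IsTestFunction U (dy φ) := hφ.fderiv_apply (0, 1)
    rw [setIntegral_sub_mul h.locInt h'.locInt hd, h.weak_y φ hφ, h'.weak_y φ hφ]
    have := setIntegral_sub_mul h.locInt_y h'.locInt_y hφ
    simp only [Prod.snd_sub]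
    rw [this]
    ring

theorem _root_.MeasureTheory.LocallyIntegrableOn.comp_shift {a b : ℝ} {f : ℝ × ℝ → ℝ}
    (hf : LocallyIntegrableOn f (strip a b)) (s : ℝ) :
    LocallyIntegrableOn (fun z => f (z + (s, 0))) (strip a b) := by
  rw [locallyIntegrableOn_iff (isOpen_strip a b).isLocallyClosed] at hf ⊢
  intro k hk hkc
  set e := Homeomorph.addRight ((s, 0) : ℝ × ℝ)
  have h1 := hf (e '' k) (by
    rintro _ ⟨z, hz, rfl⟩
    simpa [e, mem_strip] using mem_strip.1 (hk hz)) (hkc.image e.continuous)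
  have h2 := ((measurePreserving_add_right volume ((s, 0) : ℝ × ℝ)).integrableOn_comp_preimage
    e.measurableEmbedding (s := e '' k) (f := f)).2 h1
  rwa [show (fun x => x + ((s, 0) : ℝ × ℝ)) ⁻¹' (e '' k) = k from
    preimage_image_eq k e.injective] at h2

theorem _root_.setIntegral_strip_comp_shift {a b : ℝ} (f : ℝ × ℝ → ℝ) (s : ℝ) :
    ∫ z in strip a b, f (z + (s, 0)) = ∫ z in strip a b, f z := by
  have h := (measurePreserving_add_right volume ((s, 0) : ℝ × ℝ)).setIntegral_preimage_emb
    (Homeomorph.addRight ((s, 0) : ℝ × ℝ)).measurableEmbedding f (strip a b)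
  rwa [show (fun x => x + ((s, 0) : ℝ × ℝ)) ⁻¹' (strip a b) = strip a b by
    ext z; simp [mem_strip]] at h

theorem _root_.fderiv_comp_add_right' (φ : ℝ × ℝ → ℝ) (s z e : ℝ × ℝ) :
    fderiv ℝ (fun w => φ (w + s)) z e = fderiv ℝ φ (z + s) e := by
  rw [fderiv_comp_add_right]

theorem comp_shift {a b : ℝ} (h : HasWeakGradient (strip a b) f g) (s : ℝ) :
    HasWeakGradient (strip a b) (fun z => f (z + (s, 0))) (fun z => g (z + (s, 0))) := by
  have ht : ∀ φ, IsTestFunction (strip a b) φ →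
      IsTestFunction (strip a b) (fun z => φ (z + (-s, 0))) := fun φ hφ =>
    hφ.comp_add_right _ fun z hz => by simpa [mem_strip] using hz
  have hz : ∀ z : ℝ × ℝ, z + (s, 0) + (-s, 0) = z := fun z => by ext <;> simp
  refine ⟨h.locInt.comp_shift s, h.locInt_x.comp_shift s, h.locInt_y.comp_shift s, ?_, ?_⟩
  · intro φ hφ
    have h1 := h.weak_x _ (ht φ hφ)
    rw [← setIntegral_strip_comp_shift _ s, ← setIntegral_strip_comp_shift (fun z => (g z).1 * _) s]
      at h1
    simpa only [dx, fderiv_comp_add_right', hz] using h1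
  · intro φ hφ
    have h1 := h.weak_y _ (ht φ hφ)
    rw [← setIntegral_strip_comp_shift _ s, ← setIntegral_strip_comp_shift (fun z => (g z).2 * _) s]
      at h1
    simpa only [dy, fderiv_comp_add_right', hz] using h1

/-- The weak gradient of a function on the channel is, almost everywhere, a function on the
channel. -/
theorem ae_periodic {L a b : ℝ} (h : HasWeakGradient (strip a b) f g) (hf : IsXPeriodic L a b f) :
    ∀ᵐ z, z ∈ strip a b → g (z + (L, 0)) = g z := by
  refine ae_unique (isOpen_strip a b) (h.comp_shift L) h fun z hz => ?_
  have := hf z.1 z.2 (mem_strip.1 hz)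
  simpa [Prod.add_def] using this

theorem of_contDiffOn {a b : ℝ} {v : ℝ → ℝ} (hab : a < b) (hv : ContDiffOn ℝ 1 v (Icc a b)) :
    HasWeakGradient (strip a b) (fun z => v z.2) (fun z => (0, derivWithin v (Icc a b) z.2)) := by
  have hcv : ContinuousOn (fun z : ℝ × ℝ => v z.2) (strip a b) :=
    hv.continuousOn.comp continuousOn_snd fun z hz => Ioo_subset_Icc_self (mem_strip.1 hz)
  have hcv' : ContinuousOn (fun z : ℝ × ℝ => derivWithin v (Icc a b) z.2) (strip a b) :=
    (hv.continuousOn_derivWithin (uniqueDiffOn_Icc hab) (by simp)).comp continuousOn_snd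
      fun z hz => Ioo_subset_Icc_self (mem_strip.1 hz)
  have hms := (isOpen_strip a b).measurableSet
  have hlv := hcv.locallyIntegrableOn (μ := volume) hms
  have hlv' := hcv'.locallyIntegrableOn (μ := volume) hms
  have hdiff : ∀ z ∈ strip a b, HasFDerivAt (fun z : ℝ × ℝ => v z.2)
      ((derivWithin v (Icc a b) z.2) • ContinuousLinearMap.snd ℝ ℝ ℝ) z := by
    intro z hz
    have hn : Icc a b ∈ 𝓝 z.2 := Icc_mem_nhds (mem_strip.1 hz).1 (mem_strip.1 hz).2
    have h1 : HasDerivAt v (derivWithin v (Icc a b) z.2) z.2 :=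
      ((hv.differentiableOn (by simp) z.2
        (Ioo_subset_Icc_self (mem_strip.1 hz))).hasDerivWithinAt).hasDerivAt hn
    exact h1.comp_hasFDerivAt z hasFDerivAt_snd
  have hint : ∀ {F ψ : ℝ × ℝ → ℝ}, LocallyIntegrableOn F (strip a b) →
      IsTestFunction (strip a b) ψ → Integrable fun z => F z * ψ z := fun {F ψ} hF hψ => by
    refine (integrableOn_iff_integrable_of_support_subset (s := strip a b) fun z hz => ?_).1
      (LocallyIntegrableOn.integrableOn_mul_test hF hψ)
    by_contra h
    exact (right_ne_zero_of_mul hz) (hψ.eq_zero_of_notMem h)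
  have hset : ∀ (F : ℝ × ℝ → ℝ) {ψ : ℝ × ℝ → ℝ}, IsTestFunction (strip a b) ψ →
      ∫ z in strip a b, F z * ψ z = ∫ z, F z * ψ z := fun F ψ hψ =>
    setIntegral_eq_integral_of_forall_compl_eq_zero fun z hz => by simp [hψ.eq_zero_of_notMem hz]
  have hparts : ∀ (e : ℝ × ℝ) (φ), IsTestFunction (strip a b) φ →
      ∫ z in strip a b, v z.2 * fderiv ℝ φ z e
        = -∫ z in strip a b, (derivWithin v (Icc a b) z.2 * e.2) * φ z := by
    intro e φ hφ
    rw [hset _ (hφ.fderiv_apply e), hset _ hφ]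
    refine integral_bilinear_hasLineDerivAt_right_eq_neg_left_of_integrable
      (B := ContinuousLinearMap.mul ℝ ℝ) (v := e) (f := fun z : ℝ × ℝ => v z.2)
      (f' := fun z => derivWithin v (Icc a b) z.2 * e.2) (g := φ)
      (g' := fun z => fderiv ℝ φ z e) ?_ ?_ ?_ ?_ ?_
    · exact hint ((hcv'.mul continuousOn_const).locallyIntegrableOn hms) hφ
    · exact hint hlv (hφ.fderiv_apply e)
    · exact hint hlv hφ
    · intro z hz
      simpa using (hdiff z (hφ.support hz)).hasLineDerivAt e
    · intro z _
      exact ((hφ.smooth.differentiable (by simp) z).hasFDerivAt).hasLineDerivAt e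
  refine ⟨hlv, ?_, hlv', fun φ hφ => ?_, fun φ hφ => ?_⟩
  · exact (continuousOn_const (c := (0 : ℝ))).locallyIntegrableOn hms
  · simpa [dx] using hparts (1, 0) φ hφ
  · simpa [dy] using hparts (0, 1) φ hφ

end HasWeakGradient

/-! ### Periodic functions on a window of four period cells -/

/-- Four consecutive period cells `(-2L, 2L) × (a, b)`. Test functions will be supported over
`[-L, L]`, which leaves room for mollification and for shifts by one period. -/
def window (L a b : ℝ) : Set (ℝ × ℝ) := Ioo (-(2 * L)) (2 * L) ×ˢ Ioo a b

theorem isOpen_window (L a b : ℝ) : IsOpen (window L a b) := isOpen_Ioo.prod isOpen_Ioo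

theorem measurableSet_window (L a b : ℝ) : MeasurableSet (window L a b) :=
  (isOpen_window L a b).measurableSet

theorem window_subset_strip (L a b : ℝ) : window L a b ⊆ strip a b := fun _ hz =>
  mem_strip.2 hz.2

theorem volume_window_ne_top (L a b : ℝ) : volume (window L a b) ≠ ⊤ := by
  rw [window, Measure.volume_eq_prod, Measure.prod_prod]
  exact ENNReal.mul_ne_top (by simp) (by simp)

theorem setLIntegral_Ico_shift {L a b : ℝ} {H : ℝ × ℝ → ℝ≥0∞}
    (hH : ∀ᵐ z, z ∈ strip a b → H (z + (L, 0)) = H z) (x₀ : ℝ) :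
    ∫⁻ z in Ico (x₀ + L) (x₀ + L + L) ×ˢ Ioo a b, H z
      = ∫⁻ z in Ico x₀ (x₀ + L) ×ˢ Ioo a b, H z := by
  have h := (measurePreserving_add_right volume ((L, 0) : ℝ × ℝ)).setLIntegral_comp_preimage_emb
    (Homeomorph.addRight ((L, 0) : ℝ × ℝ)).measurableEmbedding H
    (Ico (x₀ + L) (x₀ + L + L) ×ˢ Ioo a b)
  have hpre : (fun x => x + ((L, 0) : ℝ × ℝ)) ⁻¹' (Ico (x₀ + L) (x₀ + L + L) ×ˢ Ioo a b)
      = Ico x₀ (x₀ + L) ×ˢ Ioo a b := by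
    ext z; simp
  rw [hpre] at h
  rw [← h]
  refine setLIntegral_congr_fun_ae (measurableSet_Ico.prod measurableSet_Ioo) ?_
  filter_upwards [hH] with z hz hmem
  exact hz (mem_strip.2 hmem.2)

theorem setLIntegral_window_le {L a b : ℝ} {H : ℝ × ℝ → ℝ≥0∞}
    (hH : ∀ᵐ z, z ∈ strip a b → H (z + (L, 0)) = H z) :
    ∫⁻ z in window L a b, H z ≤ 4 * ∫⁻ z in cell L a b, H z := by
  set T : ℝ → Set (ℝ × ℝ) := fun x₀ => Ico x₀ (x₀ + L) ×ˢ Ioo a b with hT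
  set I := ∫⁻ z in cell L a b, H z
  have h0 : ∫⁻ z in T 0, H z = I := by
    refine setLIntegral_congr ?_
    simp only [hT, cell, zero_add]
    exact Measure.set_prod_ae_eq Ioo_ae_eq_Ico.symm (ae_eq_refl _)
  have h1 : ∫⁻ z in T L, H z = I := by
    rw [← h0, hT]
    simpa using setLIntegral_Ico_shift hH 0
  have h2 : ∫⁻ z in T (-L), H z = I := by
    rw [← h0, hT]
    have := setLIntegral_Ico_shift hH (-L)
    simp only [neg_add_cancel, zero_add] at this
    simpa using this.symm
  have h3 : ∫⁻ z in T (-(2 * L)), H z = I := by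
    rw [← h2, hT]
    have := setLIntegral_Ico_shift hH (-(2 * L))
    simp only [show -(2 * L) + L = -L by ring] at this
    simpa [show -(2 * L) + L = -L by ring] using this.symm
  have hsub : window L a b ⊆ (T (-(2 * L)) ∪ T (-L)) ∪ (T 0 ∪ T L) := by
    rintro z ⟨⟨hx1, hx2⟩, hy⟩
    simp only [hT, mem_union, mem_prod, mem_Ico, hy, and_true]
    rcases lt_or_ge z.1 (-L) with h | h
    · exact Or.inl (Or.inl ⟨hx1.le, by linarith⟩)
    rcases lt_or_ge z.1 0 with h' | h'
    · exact Or.inl (Or.inr ⟨h, by linarith⟩)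
    rcases lt_or_ge z.1 L with h'' | h''
    · exact Or.inr (Or.inl ⟨h', by linarith⟩)
    · exact Or.inr (Or.inr ⟨h'', by linarith⟩)
  calc ∫⁻ z in window L a b, H z ≤ _ := lintegral_mono_set hsub
    _ ≤ _ := lintegral_union_le _ _ _
    _ ≤ _ := add_le_add (lintegral_union_le _ _ _) (lintegral_union_le _ _ _)
    _ = 4 * I := by rw [h0, h1, h2, h3]; ring

/-- An `x`-periodic property that holds almost everywhere on a period cell holds almost
everywhere on the strip. -/
theorem ae_strip_of_ae_cell {L a b : ℝ} (hL : 0 < L) {P : ℝ × ℝ → Prop}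
    (hP : ∀ z ∈ strip a b, P (z + (L, 0)) ↔ P z)
    (h : ∀ᵐ z : ℝ × ℝ, z ∈ Ico 0 L ×ˢ Ioo a b → P z) : ∀ᵐ z : ℝ × ℝ, z ∈ strip a b → P z := by
  have hnat : ∀ (n : ℕ), ∀ z ∈ strip a b, P (z + (n * L, 0)) ↔ P z := by
    intro n
    induction n with
    | zero =>
      intro z _
      rw [show z + ((0 : ℕ) * L, 0) = z by ext <;> simp]
    | succ n ih =>
      intro z hz
      rw [← ih z hz, ← hP (z + (n * L, 0)) (mem_strip.2 (by simpa using mem_strip.1 hz))]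
      have : z + ((n + 1 : ℕ) * L, 0) = z + (n * L, 0) + (L, 0) := by
        ext <;> simp; ring
      rw [this]
  have hint : ∀ (n : ℤ), ∀ z ∈ strip a b, P (z + (n * L, 0)) ↔ P z := by
    intro n z hz
    obtain ⟨k, rfl | rfl⟩ := n.eq_nat_or_neg
    · exact_mod_cast hnat k z hz
    · rw [← hnat k _ (mem_strip.2 (by simpa using mem_strip.1 hz))]
      have : z + (((-(k : ℤ) : ℤ) : ℝ) * L, 0) + ((k : ℝ) * L, 0) = z := by ext <;> simp
      rw [this]
  have hall : ∀ᵐ z : ℝ × ℝ, ∀ n : ℤ, z + (n * L, 0) ∈ Ico 0 L ×ˢ Ioo a b →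
      P (z + (n * L, 0)) := by
    rw [ae_all_iff]
    exact fun n => (quasiMeasurePreserving_add_right volume _).ae h
  filter_upwards [hall] with z hz hmem
  obtain ⟨n, hn, -⟩ := existsUnique_add_zsmul_mem_Ico hL z.1 0
  rw [← hint n z hmem]
  refine hz n ⟨?_, ?_⟩
  · simpa using hn
  · simpa using mem_strip.1 hmem

/-- On functions on the channel, the `L^q` norm over the window is controlled by the `L^p` norm
over a period cell when `q ≤ p`. -/
theorem exists_window_const (L a b : ℝ) {p : ℝ≥0∞} {q : ℝ} (hq : 1 ≤ q)
    (hqp : ENNReal.ofReal q ≤ p) :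
    ∃ C : ℝ≥0∞, C ≠ ⊤ ∧ ∀ f : ℝ × ℝ → ℝ,
      AEStronglyMeasurable f (volume.restrict (cell L a b)) →
      (∀ᵐ z, z ∈ strip a b → f (z + (L, 0)) = f z) →
      (∫⁻ z in window L a b, ‖f z‖ₑ ^ q) ^ (1 / q)
        ≤ C * eLpNorm f p (volume.restrict (cell L a b)) := by
  have hq0 : 0 < q := by linarith
  have hvol : volume (cell L a b) ≠ ⊤ := by
    rw [cell, Measure.volume_eq_prod, Measure.prod_prod]
    exact ENNReal.mul_ne_top (by simp) (by simp)
  have hexp : 0 ≤ 1 / (ENNReal.ofReal q).toReal - 1 / p.toReal := by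
    rw [ENNReal.toReal_ofReal hq0.le, sub_nonneg]
    rcases eq_or_ne p ⊤ with rfl | hp
    · simp [hq0.le]
    · exact one_div_le_one_div_of_le hq0 ((ENNReal.ofReal_le_iff_le_toReal hp).1 hqp)
  refine ⟨4 ^ (1 / q) * volume (cell L a b) ^ (1 / (ENNReal.ofReal q).toReal - 1 / p.toReal),
    ENNReal.mul_ne_top (ENNReal.rpow_ne_top_of_nonneg (by positivity) (by simp))
      (ENNReal.rpow_ne_top_of_nonneg hexp hvol), fun f hf hper => ?_⟩
  have h1 : ∫⁻ z in window L a b, ‖f z‖ₑ ^ q ≤ 4 * ∫⁻ z in cell L a b, ‖f z‖ₑ ^ q :=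
    setLIntegral_window_le (by filter_upwards [hper] with z hz hmem; rw [hz hmem])
  have h2 := eLpNorm_le_eLpNorm_mul_rpow_measure_univ hqp hf
  rw [eLpNorm_eq_lintegral_rpow_enorm_toReal (by simpa using hq0) ENNReal.ofReal_ne_top,
    Measure.restrict_apply_univ] at h2
  simp only [ENNReal.toReal_ofReal hq0.le] at h2 ⊢
  calc _ ≤ (4 * ∫⁻ z in cell L a b, ‖f z‖ₑ ^ q) ^ (1 / q) :=
        ENNReal.rpow_le_rpow h1 (by positivity)
    _ = 4 ^ (1 / q) * (∫⁻ z in cell L a b, ‖f z‖ₑ ^ q) ^ (1 / q) :=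
        ENNReal.mul_rpow_of_nonneg _ _ (by positivity)
    _ ≤ 4 ^ (1 / q) * _ := mul_le_mul_right h2 _
    _ = _ := by ring

/-! ### The sup norm bound -/

theorem IsMollifier.exists_subseq_tendsto_ae {k : ℕ → ℝ × ℝ → ℝ} {c : ℕ → ℝ × ℝ} {δ : ℕ → ℝ}
    (hk : ∀ n, IsMollifier (k n) (c n) (δ n)) (hc : Tendsto c atTop (𝓝 0))
    (hδ : Tendsto δ atTop (𝓝 0)) {q : ℝ≥0∞} (hq : 1 ≤ q) (hq' : q ≠ ⊤) {F : ℝ × ℝ → ℝ}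
    (hF : MemLp F q volume) :
    ∃ ns : ℕ → ℕ, StrictMono ns ∧
      ∀ᵐ z, Tendsto (fun n => mollify (k (ns n)) F z) atTop (𝓝 (F z)) := by
  refine TendstoInMeasure.exists_seq_tendsto_ae (tendstoInMeasure_of_tendsto_eLpNorm
    (by rintro rfl; simp at hq) (fun n => ?_) hF.1
    (IsMollifier.tendsto_eLpNorm_mollify_sub hk hc hδ hq hq' hF))
  exact ((hk n).contDiff_mollify (hF.locallyIntegrable hq)).continuous.aestronglyMeasurable

theorem enorm_fderiv_le (f : ℝ × ℝ → ℝ) (z : ℝ × ℝ) :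
    ‖fderiv ℝ f z‖ₑ ≤ ‖fderiv ℝ f z (1, 0)‖ₑ + ‖fderiv ℝ f z (0, 1)‖ₑ := by
  set A := fderiv ℝ f z
  have h : ‖A‖ ≤ ‖A (1, 0)‖ + ‖A (0, 1)‖ := by
    refine A.opNorm_le_bound (by positivity) fun w => ?_
    have hw : A w = w.1 * A (1, 0) + w.2 * A (0, 1) := by
      rw [← smul_eq_mul, ← smul_eq_mul, ← map_smul, ← map_smul, ← map_add]
      simp
    rw [hw]
    refine (norm_add_le _ _).trans ?_
    rw [norm_mul, norm_mul, add_mul]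
    have h1 := norm_fst_le w
    have h2 := norm_snd_le w
    nlinarith [norm_nonneg (A (1, 0)), norm_nonneg (A (0, 1))]
  rw [← ofReal_norm, ← ofReal_norm, ← ofReal_norm, ← ENNReal.ofReal_add (norm_nonneg _)
    (norm_nonneg _)]
  exact ENNReal.ofReal_le_ofReal h

/-- The restriction of a weak gradient on the strip to the window, extended by zero. -/
theorem HasWeakGradient.hasWeakDeriv_window {L a b : ℝ} {f : ℝ × ℝ → ℝ} {g : ℝ × ℝ → ℝ × ℝ}
    (h : HasWeakGradient (strip a b) f g)
    (hf : LocallyIntegrable ((window L a b).indicator f))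
    (hx : LocallyIntegrable ((window L a b).indicator fun z => (g z).1))
    (hy : LocallyIntegrable ((window L a b).indicator fun z => (g z).2)) :
    HasWeakDeriv (window L a b) (1, 0) ((window L a b).indicator f)
        ((window L a b).indicator fun z => (g z).1) ∧
      HasWeakDeriv (window L a b) (0, 1) ((window L a b).indicator f)
        ((window L a b).indicator fun z => (g z).2) := by
  have hms := (isOpen_strip a b).measurableSet
  have hsub := window_subset_strip L a b
  refine ⟨⟨hf, hx, fun φ hφ => ?_⟩, ⟨hf, hy, fun φ hφ => ?_⟩⟩
  · rw [integral_indicator_mul_eq hms hsub _ fun z hz => (hφ.fderiv_apply _).eq_zero_of_notMem hz,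
      integral_indicator_mul_eq hms hsub _ fun z hz => hφ.eq_zero_of_notMem hz]
    exact h.weak_x φ (hφ.mono hsub)
  · rw [integral_indicator_mul_eq hms hsub _ fun z hz => (hφ.fderiv_apply _).eq_zero_of_notMem hz,
      integral_indicator_mul_eq hms hsub _ fun z hz => hφ.eq_zero_of_notMem hz]
    exact h.weak_y φ (hφ.mono hsub)

theorem lintegral_indicator_enorm_rpow {S : Set (ℝ × ℝ)} (hS : MeasurableSet S) (f : ℝ × ℝ → ℝ)
    {q : ℝ} (hq : 0 < q) : ∫⁻ z, ‖S.indicator f z‖ₑ ^ q = ∫⁻ z in S, ‖f z‖ₑ ^ q := by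
  rw [← lintegral_indicator hS]
  refine lintegral_congr fun z => ?_
  by_cases hz : z ∈ S <;> simp [hz, hq]

theorem memLp_indicator_of_setLIntegral {S : Set (ℝ × ℝ)} (hS : MeasurableSet S) {f : ℝ × ℝ → ℝ}
    {q : ℝ} (hq : 0 < q) (hf : AEStronglyMeasurable f (volume.restrict S))
    (h : (∫⁻ z in S, ‖f z‖ₑ ^ q) ^ (1 / q) ≠ ⊤) :
    MemLp (S.indicator f) (ENNReal.ofReal q) volume := by
  refine ⟨(aestronglyMeasurable_indicator_iff hS).2 hf, ?_⟩
  rw [eLpNorm_eq_lintegral_rpow_enorm_toReal (by simpa using hq) ENNReal.ofReal_ne_top,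
    ENNReal.toReal_ofReal hq.le, lintegral_indicator_enorm_rpow hS f hq]
  exact lt_top_iff_ne_top.2 h

/-- The embedding of `W^{1,p}` of the channel into `L^∞` for `p > 2`: mollify in the window, and
apply Morrey's inequality on a ball of fixed radius that contains the given point and lies
in the strip. -/
theorem exists_sup_const {L a b : ℝ} (hL : 0 < L) (hab : a < b) {p : ℝ≥0∞} (hp : 2 < p) :
    ∃ C : ℝ≥0∞, C ≠ ⊤ ∧ ∀ (f : ℝ × ℝ → ℝ) (g : ℝ × ℝ → ℝ × ℝ),
      IsXPeriodic L a b f → HasWeakGradient (strip a b) f g →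
      eLpNorm f p (volume.restrict (cell L a b))
        + eLpNorm (fun z => (g z).1) p (volume.restrict (cell L a b))
        + eLpNorm (fun z => (g z).2) p (volume.restrict (cell L a b)) ≠ ⊤ →
      ∀ᵐ z, z ∈ strip a b → ‖f z‖ₑ ≤ C * (eLpNorm f p (volume.restrict (cell L a b))
        + eLpNorm (fun z => (g z).1) p (volume.restrict (cell L a b))
        + eLpNorm (fun z => (g z).2) p (volume.restrict (cell L a b))) := by
  obtain ⟨q, hq2, hqp⟩ : ∃ q : ℝ, 2 < q ∧ ENNReal.ofReal q ≤ p := by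
    obtain ⟨s, hs1, hs2⟩ := ENNReal.lt_iff_exists_nnreal_btwn.1 hp
    exact ⟨s, by exact_mod_cast hs1, by simpa using hs2.le⟩
  have hq0 : 0 < q := by linarith
  set r := min (L / 2) ((b - a) / 4) with hr
  have hr0 : 0 < r := lt_min (by linarith) (by linarith)
  have hrL : r ≤ L / 2 := min_le_left _ _
  have hrb : r ≤ (b - a) / 4 := min_le_right _ _
  obtain ⟨CM, hCM, hmorrey⟩ := exists_morrey_const hr0 hq2
  obtain ⟨CW, hCW, hwin⟩ := exists_window_const L a b (by linarith : 1 ≤ q) hqp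
  refine ⟨CM * CW, ENNReal.mul_ne_top hCM hCW, fun f g hf h hN => ?_⟩
  have hsub := window_subset_strip L a b
  have hms := measurableSet_window L a b
  have hcs : cell L a b ⊆ strip a b := fun z hz => mem_strip.2 hz.2
  have hper := h.ae_periodic hf
  have hf' : ∀ᵐ z, z ∈ strip a b → f (z + (L, 0)) = f z := ae_of_all _ fun z hz => by
    simpa [Prod.add_def] using hf z.1 z.2 (mem_strip.1 hz)
  have hm : ∀ {G : ℝ × ℝ → ℝ}, LocallyIntegrableOn G (strip a b) → ∀ {S}, S ⊆ strip a b →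
      AEStronglyMeasurable G (volume.restrict S) := fun hG S hS =>
    (hG.aestronglyMeasurable).mono_measure (Measure.restrict_mono hS le_rfl)
  set N0 := eLpNorm f p (volume.restrict (cell L a b))
  set N1 := eLpNorm (fun z => (g z).1) p (volume.restrict (cell L a b))
  set N2 := eLpNorm (fun z => (g z).2) p (volume.restrict (cell L a b))
  have hN01 := ENNReal.add_ne_top.1 hN
  have hN0 := (ENNReal.add_ne_top.1 hN01.1).1
  have hN1 := (ENNReal.add_ne_top.1 hN01.1).2
  have w0 := hwin f (hm h.locInt hcs) hf'
  have w1 := hwin (fun z => (g z).1) (hm h.locInt_x hcs)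
    (by filter_upwards [hper] with z hz hmem; rw [hz hmem])
  have w2 := hwin (fun z => (g z).2) (hm h.locInt_y hcs)
    (by filter_upwards [hper] with z hz hmem; rw [hz hmem])
  have m0 := memLp_indicator_of_setLIntegral hms hq0 (hm h.locInt hsub)
    (ne_top_of_le_ne_top (ENNReal.mul_ne_top hCW hN0) w0)
  have m1 := memLp_indicator_of_setLIntegral hms hq0 (hm h.locInt_x hsub)
    (ne_top_of_le_ne_top (ENNReal.mul_ne_top hCW hN1) w1)
  have m2 := memLp_indicator_of_setLIntegral hms hq0 (hm h.locInt_y hsub)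
    (ne_top_of_le_ne_top (ENNReal.mul_ne_top hCW hN01.2) w2)
  rw [← lintegral_indicator_enorm_rpow hms _ hq0] at w0 w1 w2
  set F := (window L a b).indicator f
  set Gx := (window L a b).indicator fun z => (g z).1
  set Gy := (window L a b).indicator fun z => (g z).2
  have hq1 : 1 ≤ ENNReal.ofReal q := by simpa using (by linarith : 1 ≤ q)
  obtain ⟨wx, wy⟩ := h.hasWeakDeriv_window (L := L) (m0.locallyIntegrable hq1)
    (m1.locallyIntegrable hq1) (m2.locallyIntegrable hq1)
  choose k hk using fun n : ℕ => exists_isMollifier 0 (δ := 1 / ((n : ℝ) + 1)) (by positivity)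
  have hδ := tendsto_one_div_add_atTop_nhds_zero_nat (𝕜 := ℝ)
  obtain ⟨ns, hns, hlim⟩ := IsMollifier.exists_subseq_tendsto_ae hk tendsto_const_nhds hδ hq1
    ENNReal.ofReal_ne_top m0
  refine ae_strip_of_ae_cell hL (fun z hz => ?_) ?_
  · have := hf z.1 z.2 (mem_strip.1 hz)
    rw [show z + (L, 0) = (z.1 + L, z.2) by ext <;> simp, this]
  filter_upwards [hlim] with z hz hmem
  have hzw : z ∈ window L a b := ⟨⟨by linarith [hmem.1.1], by linarith [hmem.1.2]⟩, hmem.2⟩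
  have hFz : F z = f z := indicator_of_mem hzw f
  rw [← hFz]
  refine le_of_tendsto (hz.enorm) ?_
  -- the centre of the ball is obtained from `z` by contracting towards the midline
  set mid := (a + b) / 2 with hmid
  set θ := 2 * r / (b - a) with hθ
  have hθ0 : 0 < θ := div_pos (by linarith) (by linarith)
  have hθ1 : θ ≤ 1 / 2 := by
    rw [hθ, div_le_iff₀ (by linarith)]
    linarith
  have hθr : θ * ((b - a) / 2) = r := by
    rw [hθ]
    field_simp [(sub_pos.2 hab).ne']
  have hy : |z.2 - mid| < (b - a) / 2 := by
    rw [abs_lt]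
    constructor <;> linarith [hmem.2.1, hmem.2.2]
  set c : ℝ × ℝ := (z.1, z.2 - θ * (z.2 - mid)) with hc
  have hzc : z ∈ Metric.ball c r := by
    rw [mem_ball_iff_norm, Prod.norm_def, max_lt_iff]
    refine ⟨by simpa [hc] using hr0, ?_⟩
    simp only [hc, Prod.snd_sub, sub_sub_cancel, Real.norm_eq_abs, abs_mul, abs_of_pos hθ0]
    nlinarith
  set η := min (r / 2) ((1 - θ) * ((b - a) / 2 - |z.2 - mid|)) with hη
  have hη0 : 0 < η := lt_min (by linarith) (mul_pos (by linarith) (by linarith))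
  have hball : ∀ w ∈ Metric.ball c r, ∀ d < η, Metric.closedBall w d ⊆ window L a b := by
    intro w hw d hd s hs
    rw [mem_ball_iff_norm, Prod.norm_def, max_lt_iff] at hw
    rw [mem_closedBall_iff_norm, Prod.norm_def, max_le_iff] at hs
    simp only [hc, Prod.fst_sub, Prod.snd_sub, Real.norm_eq_abs, abs_lt, abs_le] at hw hs
    have hd1 := hd.trans_le (min_le_left _ _)
    have hd2 := hd.trans_le (min_le_right _ _)
    have h1 := le_abs_self (z.2 - mid)
    have h2 := neg_abs_le (z.2 - mid)
    have hx := hmem.1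
    have h3 : (1 - θ) * (z.2 - mid) ≤ (1 - θ) * |z.2 - mid| :=
      mul_le_mul_of_nonneg_left h1 (by linarith)
    have h4 : (1 - θ) * (-|z.2 - mid|) ≤ (1 - θ) * (z.2 - mid) :=
      mul_le_mul_of_nonneg_left h2 (by linarith)
    have hmr : (1 - θ) * ((b - a) / 2 - |z.2 - mid|)
        = (b - a) / 2 - r - (1 - θ) * |z.2 - mid| := by rw [← hθr]; ring
    rw [hmr] at hd2
    refine ⟨⟨?_, ?_⟩, ?_, ?_⟩
    · linarith [hx.1, hw.1.1, hs.1.1]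
    · linarith [hx.2, hw.1.2, hs.1.2]
    · have e : z.2 - θ * (z.2 - mid) = mid + (1 - θ) * (z.2 - mid) := by ring
      rw [e] at hw
      linarith [hw.2.1, hs.2.1]
    · have e : z.2 - θ * (z.2 - mid) = mid + (1 - θ) * (z.2 - mid) := by ring
      rw [e] at hw
      linarith [hw.2.2, hs.2.2]
  have hev : ∀ᶠ n in atTop, 1 / (((ns n : ℕ) : ℝ) + 1) < η :=
    (hδ.comp hns.tendsto_atTop).eventually (gt_mem_nhds hη0)
  filter_upwards [hev] with n hn
  set κ := k (ns n)
  have hκ := hk (ns n)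
  have hsm := (hκ.contDiff_mollify wx.locInt).of_le (by simp : (1 : WithTop ℕ∞) ≤ (⊤ : ℕ∞))
  refine (hmorrey _ c z hsm hzc).trans ?_
  rw [mul_assoc]
  refine mul_le_mul_right ?_ _
  have hle : ∀ {H : ℝ × ℝ → ℝ}, MemLp H (ENNReal.ofReal q) volume →
      (∫⁻ w in Metric.ball c r, ‖mollify κ H w‖ₑ ^ q) ^ (1 / q)
        ≤ (∫⁻ w, ‖H w‖ₑ ^ q) ^ (1 / q) := fun hH =>
    ENNReal.rpow_le_rpow ((setLIntegral_le_lintegral _ _).trans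
      (hκ.lintegral_mollify_le hH.1 (by linarith))) (by positivity)
  have hmeas : ∀ {H : ℝ × ℝ → ℝ}, MemLp H (ENNReal.ofReal q) volume →
      AEMeasurable (fun w => ‖mollify κ H w‖ₑ) (volume.restrict (Metric.ball c r)) := fun hH =>
    ((hκ.contDiff_mollify (hH.locallyIntegrable hq1)).continuous.enorm.measurable).aemeasurable
  have hgrad : (∫⁻ w in Metric.ball c r, ‖fderiv ℝ (mollify κ F) w‖ₑ ^ q) ^ (1 / q)
      ≤ (∫⁻ w, ‖Gx w‖ₑ ^ q) ^ (1 / q) + (∫⁻ w, ‖Gy w‖ₑ ^ q) ^ (1 / q) := by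
    calc _ ≤ (∫⁻ w in Metric.ball c r,
          ((fun w => ‖mollify κ Gx w‖ₑ) + fun w => ‖mollify κ Gy w‖ₑ) w ^ q) ^ (1 / q) := by
          refine ENNReal.rpow_le_rpow (setLIntegral_mono' measurableSet_ball fun w hw => ?_)
            (by positivity)
          refine ENNReal.rpow_le_rpow ?_ hq0.le
          have hcb : Metric.closedBall (w - 0) (1 / (((ns n : ℕ) : ℝ) + 1)) ⊆ window L a b := by
            rw [sub_zero]
            exact hball w hw _ hn
          refine (enorm_fderiv_le _ w).trans ?_
          rw [hκ.fderiv_mollify wx hcb, hκ.fderiv_mollify wy hcb]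
          rfl
      _ ≤ _ := ENNReal.lintegral_Lp_add_le (hmeas m1) (hmeas m2) (by linarith)
      _ ≤ _ := add_le_add (hle m1) (hle m2)
  calc _ ≤ CW * N0 + (CW * N1 + CW * N2) :=
        add_le_add ((hle m0).trans w0) (hgrad.trans (add_le_add w1 w2))
    _ = _ := by ring

/-! ### Passing to the limit in products -/

/-- The functions `fn n` and `f` are integrable, and the integrals converge. -/
structure TendstoIntegral (fn : ℕ → ℝ × ℝ → ℝ) (f : ℝ × ℝ → ℝ) : Prop where
  integrable_seq : ∀ n, Integrable (fn n)
  integrable : Integrable f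
  tendsto : Tendsto (fun n => ∫ z, fn n z) atTop (𝓝 (∫ z, f z))

theorem TendstoIntegral.add {fn gn : ℕ → ℝ × ℝ → ℝ} {f g : ℝ × ℝ → ℝ}
    (hf : TendstoIntegral fn f) (hg : TendstoIntegral gn g) :
    TendstoIntegral (fun n z => fn n z + gn n z) (fun z => f z + g z) where
  integrable_seq n := (hf.integrable_seq n).add (hg.integrable_seq n)
  integrable := hf.integrable.add hg.integrable
  tendsto := by
    rw [integral_add hf.integrable hg.integrable]
    refine (hf.tendsto.add hg.tendsto).congr fun n => ?_
    rw [integral_add (hf.integrable_seq n) (hg.integrable_seq n)]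

/-- Convergence of `∫ w Xₙ Yₙ` when `Xₙ` converges in `L²` and `Yₙ` is bounded and converges
only almost everywhere. -/
theorem tendsto_integral_mul_mul {w X Y : ℝ × ℝ → ℝ} {Xn Yn : ℕ → ℝ × ℝ → ℝ} {C : ℝ}
    (hw : MemLp w 2 volume) (hX : MemLp X 2 volume) (hXn : ∀ n, MemLp (Xn n) 2 volume)
    (hlim : Tendsto (fun n => eLpNorm (Xn n - X) 2 volume) atTop (𝓝 0))
    (hYm : ∀ n, AEStronglyMeasurable (Yn n) volume) (hYC : ∀ n z, |Yn n z| ≤ C)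
    (hY : ∀ᵐ z, Tendsto (fun n => Yn n z) atTop (𝓝 (Y z))) :
    TendstoIntegral (fun n z => w z * (Xn n z * Yn n z)) (fun z => w z * (X z * Y z)) := by
  have hC : 0 ≤ C := (abs_nonneg _).trans (hYC 0 0)
  have hint : ∀ {Z : ℝ × ℝ → ℝ}, MemLp Z 2 volume → ∀ n,
      Integrable fun z => w z * (Z z * Yn n z) := fun {Z} hZ n => by
    have := (hw.integrable_mul hZ).mul_bdd (hYm n) (ae_of_all _ (hYC n))
    simpa [mul_assoc] using this
  have h1 : Tendsto (fun n => ∫ z, w z * (X z * Yn n z)) atTop (𝓝 (∫ z, w z * (X z * Y z))) := by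
    refine tendsto_integral_of_dominated_convergence (fun z => |w z * X z| * C)
      (fun n => (hint hX n).1) ((hw.integrable_mul hX).abs.mul_const C) (fun n => ?_) ?_
    · refine ae_of_all _ fun z => ?_
      rw [← mul_assoc, norm_mul]
      exact mul_le_mul_of_nonneg_left (hYC n z) (abs_nonneg _)
    · filter_upwards [hY] with z hz
      exact (hz.const_mul _).const_mul _
  have h2 : Tendsto (fun n => ∫ z, w z * ((Xn n z - X z) * Yn n z)) atTop (𝓝 0) := by
    have hb : Tendsto (fun n => C * (eLpNorm w 2 volume * eLpNorm (Xn n - X) 2 volume).toReal)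
        atTop (𝓝 0) := by
      have h3 := ENNReal.Tendsto.const_mul hlim (Or.inr hw.2.ne)
      rw [mul_zero] at h3
      have h4 := (ENNReal.tendsto_toReal ENNReal.zero_ne_top).comp h3
      simpa using h4.const_mul C
    refine squeeze_zero_norm (fun n => ?_) hb
    have hd : MemLp (Xn n - X) 2 volume := (hXn n).sub hX
    have h5 : eLpNorm (w • (Xn n - X)) 1 volume
        ≤ eLpNorm w 2 volume * eLpNorm (Xn n - X) 2 volume :=
      eLpNorm_smul_le_mul_eLpNorm hd.1 hw.1
    have hi : Integrable (w • (Xn n - X)) volume := hw.integrable_mul hd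
    calc ‖∫ z, w z * ((Xn n z - X z) * Yn n z)‖
        ≤ ∫ z, ‖w z * ((Xn n z - X z) * Yn n z)‖ := norm_integral_le_integral_norm _
      _ ≤ ∫ z, C * ‖(w • (Xn n - X)) z‖ := by
          refine integral_mono (hint hd n).norm (hi.norm.const_mul C) fun z => ?_
          simp only [Pi.smul_apply', Pi.sub_apply, smul_eq_mul]
          rw [← mul_assoc, norm_mul, mul_comm]
          exact mul_le_mul_of_nonneg_right (hYC n z) (norm_nonneg _)
      _ = C * (eLpNorm (w • (Xn n - X)) 1 volume).toReal := by
          rw [integral_const_mul, eLpNorm_one_eq_lintegral_enorm, integral_norm_eq_lintegral_enorm hi.1]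
      _ ≤ _ := mul_le_mul_of_nonneg_left (ENNReal.toReal_mono
          (ENNReal.mul_ne_top hw.2.ne hd.2.ne) h5) hC
  have h6 := h2.add h1
  rw [zero_add] at h6
  refine ⟨fun n => hint (hXn n) n, ?_, h6.congr fun n => ?_⟩
  · have hYm' : AEStronglyMeasurable Y volume := aestronglyMeasurable_of_tendsto_ae atTop hYm hY
    have hYC' : ∀ᵐ z, ‖Y z‖ ≤ C := by
      filter_upwards [hY] with z hz
      exact le_of_tendsto' hz.abs fun n => hYC n z
    simpa [mul_assoc] using (hw.integrable_mul hX).mul_bdd hYm' hYC'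
  · have h7 : Integrable fun z => w z * ((Xn n z - X z) * Yn n z) := hint ((hXn n).sub hX) n
    rw [← integral_add h7 (hint hX n)]
    congr 1
    ext z
    ring

/-- A bounded continuous function that agrees with the reciprocal on `c ≤ |t|`. -/
noncomputable def truncInv (c t : ℝ) : ℝ := t / max (t ^ 2) (c ^ 2)

theorem continuous_truncInv {c : ℝ} (hc : 0 < c) : Continuous (truncInv c) := by
  unfold truncInv
  refine continuous_id.div (by fun_prop) fun t => ?_
  have : 0 < max (t ^ 2) (c ^ 2) := lt_max_of_lt_right (by positivity)
  exact this.ne'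

theorem abs_truncInv_le {c : ℝ} (hc : 0 < c) (t : ℝ) : |truncInv c t| ≤ 1 / c := by
  have h : 0 < max (t ^ 2) (c ^ 2) := lt_max_of_lt_right (by positivity)
  rw [truncInv, abs_div, abs_of_pos h, div_le_div_iff₀ h hc, one_mul]
  rcases le_total |t| c with h1 | h1
  · exact le_max_of_le_right (by nlinarith)
  · exact le_max_of_le_left (by rw [← sq_abs]; nlinarith [abs_nonneg t])

theorem truncInv_eq_inv {c t : ℝ} (hc : 0 < c) (ht : c ≤ |t|) : truncInv c t = t⁻¹ := by
  have h1 : c ^ 2 ≤ t ^ 2 := by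
    rw [← sq_abs t]
    gcongr
  have h2 : t ≠ 0 := abs_pos.1 (hc.trans_le ht)
  rw [truncInv, max_eq_left h1]
  field_simp

/-- Convergence of `∫ w ∂ₑ(ζ v / α)` along mollified `v` and `α`; here `D` and `E` stand for the
derivatives of `v` and `α`, and `ζ'` for that of `ζ`. -/
theorem tendsto_integral_mul_deriv_quotient {w V A D E ζ ζ' : ℝ × ℝ → ℝ}
    {Vn An Dn En : ℕ → ℝ × ℝ → ℝ} {M Z c : ℝ} (hc : 0 < c)
    (hw : MemLp w 2 volume) (hV : MemLp V 2 volume) (hD : MemLp D 2 volume)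
    (hE : MemLp E 2 volume) (hVn : ∀ n, MemLp (Vn n) 2 volume)
    (hDn : ∀ n, MemLp (Dn n) 2 volume) (hEn : ∀ n, MemLp (En n) 2 volume)
    (lV : Tendsto (fun n => eLpNorm (Vn n - V) 2 volume) atTop (𝓝 0))
    (lD : Tendsto (fun n => eLpNorm (Dn n - D) 2 volume) atTop (𝓝 0))
    (lE : Tendsto (fun n => eLpNorm (En n - E) 2 volume) atTop (𝓝 0))
    (aV : ∀ᵐ z, Tendsto (fun n => Vn n z) atTop (𝓝 (V z)))
    (aA : ∀ᵐ z, Tendsto (fun n => An n z) atTop (𝓝 (A z)))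
    (cA : ∀ n, Continuous (An n)) (cV : ∀ n, Continuous (Vn n)) (bV : ∀ n z, |Vn n z| ≤ M)
    (cζ : Continuous ζ) (cζ' : Continuous ζ') (bζ : ∀ z, |ζ z| ≤ Z) (bζ' : ∀ z, |ζ' z| ≤ Z) :
    TendstoIntegral (fun n z => w z * (ζ' z * Vn n z * truncInv c (An n z)
        + ζ z * (Dn n z * truncInv c (An n z) - Vn n z * En n z * truncInv c (An n z) ^ 2)))
      (fun z => w z * (ζ' z * V z * truncInv c (A z)
        + ζ z * (D z * truncInv c (A z) - V z * E z * truncInv c (A z) ^ 2))) := by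
  have hj := continuous_truncInv hc
  have hZ : 0 ≤ Z := (abs_nonneg _).trans (bζ 0)
  have hM : 0 ≤ M := (abs_nonneg _).trans (bV 0 0)
  have b0 := abs_truncInv_le hc
  -- the three bounded factors
  have b1 : ∀ n z, |ζ' z * truncInv c (An n z)| ≤ Z * (1 / c) := fun n z => by
    rw [abs_mul]
    exact mul_le_mul (bζ' z) (b0 _) (abs_nonneg _) hZ
  have b2 : ∀ n z, |ζ z * truncInv c (An n z)| ≤ Z * (1 / c) := fun n z => by
    rw [abs_mul]
    exact mul_le_mul (bζ z) (b0 _) (abs_nonneg _) hZ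
  have b3 : ∀ n z, |-(ζ z * (Vn n z * truncInv c (An n z) ^ 2))| ≤ Z * (M * (1 / c) ^ 2) :=
    fun n z => by
    rw [abs_neg, abs_mul, abs_mul, abs_pow]
    exact mul_le_mul (bζ z) (mul_le_mul (bV n z) (pow_le_pow_left₀ (abs_nonneg _) (b0 _) 2)
      (by positivity) hM) (by positivity) hZ
  have m1 : ∀ n, AEStronglyMeasurable (fun z => ζ' z * truncInv c (An n z)) volume := fun n =>
    (cζ'.mul (hj.comp (cA n))).aestronglyMeasurable
  have m2 : ∀ n, AEStronglyMeasurable (fun z => ζ z * truncInv c (An n z)) volume := fun n =>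
    (cζ.mul (hj.comp (cA n))).aestronglyMeasurable
  have m3 : ∀ n, AEStronglyMeasurable
      (fun z => -(ζ z * (Vn n z * truncInv c (An n z) ^ 2))) volume := fun n =>
    (cζ.mul ((cV n).mul ((hj.comp (cA n)).pow 2))).neg.aestronglyMeasurable
  have aj : ∀ᵐ z, Tendsto (fun n => truncInv c (An n z)) atTop (𝓝 (truncInv c (A z))) := by
    filter_upwards [aA] with z hz
    exact (hj.tendsto _).comp hz
  have a1 : ∀ᵐ z, Tendsto (fun n => ζ' z * truncInv c (An n z)) atTop
      (𝓝 (ζ' z * truncInv c (A z))) := by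
    filter_upwards [aj] with z hz
    exact hz.const_mul _
  have a2 : ∀ᵐ z, Tendsto (fun n => ζ z * truncInv c (An n z)) atTop
      (𝓝 (ζ z * truncInv c (A z))) := by
    filter_upwards [aj] with z hz
    exact hz.const_mul _
  have a3 : ∀ᵐ z, Tendsto (fun n => -(ζ z * (Vn n z * truncInv c (An n z) ^ 2))) atTop
      (𝓝 (-(ζ z * (V z * truncInv c (A z) ^ 2)))) := by
    filter_upwards [aj, aV] with z hz hz'
    exact ((hz'.mul (hz.pow 2)).const_mul _).neg
  have t1 := tendsto_integral_mul_mul hw hV hVn lV m1 b1 a1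
  have t2 := tendsto_integral_mul_mul hw hD hDn lD m2 b2 a2
  have t3 := tendsto_integral_mul_mul hw hE hEn lE m3 b3 a3
  convert (t1.add t2).add t3 using 1
  · ext n z
    ring
  · ext z
    ring

/-! ### The energy identity -/

/-- The column `(-2L, 2L) × ℝ` that contains the window. -/
def column (L : ℝ) : Set (ℝ × ℝ) := Ioo (-(2 * L)) (2 * L) ×ˢ univ

/-- A stationary flow `(A, V)` without stagnation points in the window, with all functions
extended by zero outside it. The weak derivatives of `A` live in the window. Those of `V`
live in the whole column: this encodes `V = 0` on the walls. The field `vorticity` is the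
vorticity equation in the form `div (A ∇V - V ∇A) = 0`, and `periodic` refers to
the shift by one period inside the window. -/
structure WindowFlow (L a b σ c M : ℝ) (A V Ax Ay Vx Vy : ℝ × ℝ → ℝ) : Prop where
  abs_sign : |σ| = 1
  pos : 0 < c
  memLp_A : MemLp A 2 volume
  memLp_V : MemLp V 2 volume
  memLp_Ax : MemLp Ax 2 volume
  memLp_Ay : MemLp Ay 2 volume
  memLp_Vx : MemLp Vx 2 volume
  memLp_Vy : MemLp Vy 2 volume
  abs_A_le : ∀ᵐ z, |A z| ≤ M
  abs_V_le : ∀ᵐ z, |V z| ≤ M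
  le_A : ∀ᵐ z, z ∈ window L a b → c ≤ σ * A z
  A_eq_zero : ∀ z ∉ window L a b, A z = 0
  V_eq_zero : ∀ z ∉ window L a b, V z = 0
  weak_Ax : HasWeakDeriv (window L a b) (1, 0) A Ax
  weak_Ay : HasWeakDeriv (window L a b) (0, 1) A Ay
  weak_Vx : HasWeakDeriv (column L) (1, 0) V Vx
  weak_Vy : HasWeakDeriv (column L) (0, 1) V Vy
  div_eq_zero : ∀ᵐ z, Ax z + Vy z = 0
  periodic : ∀ᵐ z : ℝ × ℝ, z.1 ∈ Ioo (-(2 * L)) L → A (z + (L, 0)) = A z ∧ V (z + (L, 0)) = V z ∧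
    Ax (z + (L, 0)) = Ax z ∧ Vx (z + (L, 0)) = Vx z
  tangent : ∀ φ, IsTestFunction (column L) φ → ∫ z, (A z * dx φ z + V z * dy φ z) = 0
  vorticity : ∀ φ, IsTestFunction (window L a b) φ →
    ∫ z, ((A z * Vx z - V z * Ax z) * dx φ z + (A z * Vy z - V z * Ay z) * dy φ z) = 0

theorem contDiff_mul_div {ζ v α : ℝ × ℝ → ℝ} (hζ : ContDiff ℝ ∞ ζ) (hv : ContDiff ℝ ∞ v)
    (hα : ContDiff ℝ ∞ α) (h0 : ∀ z ∈ tsupport ζ, z ∈ tsupport v → α z ≠ 0) :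
    ContDiff ℝ ∞ fun z => ζ z * (v z / α z) := by
  rw [contDiff_iff_contDiffAt]
  intro z
  by_cases h1 : z ∈ tsupport ζ
  · by_cases h2 : z ∈ tsupport v
    · exact hζ.contDiffAt.mul (hv.contDiffAt.div hα.contDiffAt (h0 z h1 h2))
    · refine (contDiffAt_const (c := (0 : ℝ))).congr_of_eventuallyEq ?_
      filter_upwards [notMem_tsupport_iff_eventuallyEq.1 h2] with w hw
      simp [hw]
  · refine (contDiffAt_const (c := (0 : ℝ))).congr_of_eventuallyEq ?_
    filter_upwards [notMem_tsupport_iff_eventuallyEq.1 h1] with w hw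
    simp [hw]

theorem fderiv_mul_div_of_mem {ζ v α : ℝ × ℝ → ℝ} (hζ : ContDiff ℝ ∞ ζ) (hv : ContDiff ℝ ∞ v)
    (hα : ContDiff ℝ ∞ α) {z : ℝ × ℝ} (h0 : α z ≠ 0) (e : ℝ × ℝ) :
    fderiv ℝ (fun z => ζ z * (v z / α z)) z e = fderiv ℝ ζ z e * v z * (α z)⁻¹
      + ζ z * (fderiv ℝ v z e * (α z)⁻¹ - v z * fderiv ℝ α z e * (α z)⁻¹ ^ 2) := by
  have d1 := (hζ.differentiable (by simp) z).hasFDerivAt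
  have d2 := (hv.differentiable (by simp) z).hasFDerivAt
  have d3 := (hα.differentiable (by simp) z).hasFDerivAt
  have d5 : HasFDerivAt (fun z => (α z)⁻¹) (-((α z) ^ 2)⁻¹ • fderiv ℝ α z) z :=
    (hasDerivAt_inv h0).comp_hasFDerivAt z d3
  have d4 := d1.mul (d2.mul d5)
  simp only [div_eq_mul_inv]
  have d6 : HasFDerivAt (fun z => ζ z * (v z * (α z)⁻¹)) _ z := d4
  rw [d6.fderiv]
  simp only [add_apply, smul_apply, Pi.mul_apply, smul_eq_mul, inv_pow]
  ring

theorem fderiv_mul_div_of_notMem {ζ v : ℝ × ℝ → ℝ} (α : ℝ × ℝ → ℝ) {z : ℝ × ℝ}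
    (h : z ∉ tsupport ζ ∨ z ∉ tsupport v) (e : ℝ × ℝ) :
    fderiv ℝ (fun z => ζ z * (v z / α z)) z e = 0 := by
  have : (fun z => ζ z * (v z / α z)) =ᶠ[𝓝 z] fun _ => 0 := by
    rcases h with h | h
    · filter_upwards [notMem_tsupport_iff_eventuallyEq.1 h] with w hw
      simp [hw]
    · filter_upwards [notMem_tsupport_iff_eventuallyEq.1 h] with w hw
      simp [hw]
  rw [this.fderiv_eq]
  simp

theorem memLp_mul_bdd {X Y : ℝ × ℝ → ℝ} {M : ℝ} (hX : MemLp X 2 volume)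
    (hY : AEStronglyMeasurable Y volume) (hM : ∀ᵐ z, |Y z| ≤ M) :
    MemLp (fun z => Y z * X z) 2 volume := by
  refine hX.of_le_mul (c := M) (hY.mul hX.1) ?_
  filter_upwards [hM] with z hz
  rw [norm_mul]
  exact mul_le_mul_of_nonneg_right hz (norm_nonneg _)

namespace WindowFlow

variable {L a b σ c M : ℝ} {A V Ax Ay Vx Vy : ℝ × ℝ → ℝ}

theorem memLp_W (h : WindowFlow L a b σ c M A V Ax Ay Vx Vy) {E D : ℝ × ℝ → ℝ}
    (hE : MemLp E 2 volume) (hD : MemLp D 2 volume) :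
    MemLp (fun z => A z * D z - V z * E z) 2 volume :=
  (memLp_mul_bdd hD h.memLp_A.1 h.abs_A_le).sub (memLp_mul_bdd hE h.memLp_V.1 h.abs_V_le)

theorem le_abs_A (h : WindowFlow L a b σ c M A V Ax Ay Vx Vy) :
    ∀ᵐ z, z ∈ window L a b → c ≤ |A z| := by
  filter_upwards [h.le_A] with z hz hmem
  have := (hz hmem).trans (le_abs_self _)
  rwa [abs_mul, h.abs_sign, one_mul] at this

/-- Where the kernel of `V` is centred at height `3τδ`, the mollified `V` is supported at
distance at least `2δ` from the lower wall (`τ = 1`) or from the upper wall (`τ = -1`). If `ζ`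
keeps away from the other wall, then the closed `δ`-balls about the common support
lie in the window. -/
theorem closedBall_subset_window {ζ : ℝ × ℝ → ℝ} {τ η δ : ℝ} (hV : ∀ z ∉ window L a b, V z = 0)
    (hζx : ∀ z ∈ tsupport ζ, z.1 ∈ Icc (-L) L)
    (hζy : (τ = 1 ∧ ∀ z ∈ tsupport ζ, z.2 ≤ b - η) ∨ (τ = -1 ∧ ∀ z ∈ tsupport ζ, a + η ≤ z.2))
    (hδ : 0 < δ) (hδη : δ < η) (hδL : δ < L) {k : ℝ × ℝ → ℝ}
    (hk : IsMollifier k (0, 3 * τ * δ) δ) {z : ℝ × ℝ} (hz : z ∈ tsupport ζ)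
    (hz' : z ∈ tsupport (mollify k V)) : Metric.closedBall z δ ⊆ window L a b := by
  have hmem : ∀ {w s : ℝ × ℝ}, s ∈ Metric.closedBall (w - (0, 3 * τ * δ)) δ →
      |s.2 - (w.2 - 3 * τ * δ)| ≤ δ := by
    intro w s hs
    rw [mem_closedBall_iff_norm, Prod.norm_def, max_le_iff] at hs
    simpa using hs.2
  have hy : a + δ < z.2 ∧ z.2 < b - δ := by
    rcases hζy with ⟨rfl, hζy⟩ | ⟨rfl, hζy⟩
    · have hsub : tsupport (mollify k V) ⊆ {w | a + 2 * δ ≤ w.2} := by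
        refine closure_minimal (fun w hw => ?_) (isClosed_le continuous_const continuous_snd)
        by_contra hlt
        refine hw (hk.mollify_eq_zero fun s hs => hV s fun hsw => ?_)
        have h1 := (abs_le.1 (hmem hs)).2
        have h2 : w.2 < a + 2 * δ := not_le.1 hlt
        linarith [hsw.2.1]
      have h1 : a + 2 * δ ≤ z.2 := hsub hz'
      constructor <;> linarith [hζy z hz]
    · have hsub : tsupport (mollify k V) ⊆ {w | w.2 ≤ b - 2 * δ} := by
        refine closure_minimal (fun w hw => ?_) (isClosed_le continuous_snd continuous_const)
        by_contra hlt
        refine hw (hk.mollify_eq_zero fun s hs => hV s fun hsw => ?_)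
        have h1 := (abs_le.1 (hmem hs)).1
        have h2 : b - 2 * δ < w.2 := not_le.1 hlt
        linarith [hsw.2.2]
      have h1 : z.2 ≤ b - 2 * δ := hsub hz'
      constructor <;> linarith [hζy z hz]
  intro s hs
  rw [mem_closedBall_iff_norm, Prod.norm_def, max_le_iff] at hs
  simp only [Prod.fst_sub, Prod.snd_sub, Real.norm_eq_abs, abs_le] at hs
  have hx := hζx z hz
  exact ⟨⟨by linarith [hx.1], by linarith [hx.2]⟩, by linarith [hy.1], by linarith [hy.2]⟩

/-- The weak form of `div W = 0`, with `W = A ∇V - V ∇A`, tested with `ζ V / A`, for a cutoff `ζ`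
that vanishes near one of the two walls. The test function is approximated by mollifying `V` and
`A`; the kernel of `V` is off centre and so pushes the support of `V` away from the
other wall. Since `A² ∇(V / A) = W`, the result is an energy identity for `V / A`. -/
theorem energy_identity_of_cutoff (h : WindowFlow L a b σ c M A V Ax Ay Vx Vy) (hL : 0 < L)
    {ζ : ℝ × ℝ → ℝ} {τ η : ℝ} (hζ : IsTestFunction univ ζ) (hη : 0 < η)
    (hζx : ∀ z ∈ tsupport ζ, z.1 ∈ Icc (-L) L)
    (hζy : (τ = 1 ∧ ∀ z ∈ tsupport ζ, z.2 ≤ b - η) ∨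
      (τ = -1 ∧ ∀ z ∈ tsupport ζ, a + η ≤ z.2)) :
    Integrable (fun z =>
      ζ z * (((A z * Vx z - V z * Ax z) ^ 2 + (A z * Vy z - V z * Ay z) ^ 2) * (A z)⁻¹ ^ 2)
        + ((A z * Vx z - V z * Ax z) * V z * (A z)⁻¹ * dx ζ z
          + (A z * Vy z - V z * Ay z) * V z * (A z)⁻¹ * dy ζ z)) ∧
    ∫ z, (ζ z * (((A z * Vx z - V z * Ax z) ^ 2 + (A z * Vy z - V z * Ay z) ^ 2) * (A z)⁻¹ ^ 2)
        + ((A z * Vx z - V z * Ax z) * V z * (A z)⁻¹ * dx ζ z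
          + (A z * Vy z - V z * Ay z) * V z * (A z)⁻¹ * dy ζ z)) = 0 := by
  have hτ : |τ| = 1 := by rcases hζy with ⟨rfl, -⟩ | ⟨rfl, -⟩ <;> simp
  set δ : ℕ → ℝ := fun n => 1 / ((n : ℝ) + 1) with hδdef
  have hδ0 : ∀ n, 0 < δ n := fun n => by positivity
  have hδ : Tendsto δ atTop (𝓝 0) := tendsto_one_div_add_atTop_nhds_zero_nat
  choose ρ hρ using fun n : ℕ => exists_isMollifier 0 (hδ0 n)
  choose k hk using fun n : ℕ => exists_isMollifier (0, 3 * τ * δ n) (hδ0 n)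
  have hcn : Tendsto (fun n => ((0, 3 * τ * δ n) : ℝ × ℝ)) atTop (𝓝 0) := by
    have : Tendsto (fun n => 3 * τ * δ n) atTop (𝓝 0) := by simpa using hδ.const_mul (3 * τ)
    exact tendsto_const_nhds.prodMk_nhds this
  have one_le_two' : (1 : ℝ≥0∞) ≤ 2 := by norm_num
  have two_ne_top' : (2 : ℝ≥0∞) ≠ ⊤ := by norm_num
  obtain ⟨n₁, hn₁, lim₁⟩ := IsMollifier.exists_subseq_tendsto_ae hρ tendsto_const_nhds hδ
    one_le_two' two_ne_top' h.memLp_A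
  obtain ⟨n₂, hn₂, lim₂⟩ := IsMollifier.exists_subseq_tendsto_ae (fun n => hk (n₁ n))
    (hcn.comp hn₁.tendsto_atTop) (hδ.comp hn₁.tendsto_atTop) one_le_two' two_ne_top' h.memLp_V
  set ns := n₁ ∘ n₂ with hns
  have hnsT : Tendsto ns atTop atTop := hn₁.tendsto_atTop.comp hn₂.tendsto_atTop
  have li : ∀ {F : ℝ × ℝ → ℝ}, MemLp F 2 volume → LocallyIntegrable F :=
    fun hF => hF.locallyIntegrable one_le_two'
  have mk : ∀ {F : ℝ × ℝ → ℝ}, MemLp F 2 volume → ∀ n, MemLp (mollify (k (ns n)) F) 2 volume :=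
    fun hF n => ⟨((hk _).contDiff_mollify (li hF)).continuous.aestronglyMeasurable,
      ((hk _).eLpNorm_mollify_le hF.1 one_le_two' two_ne_top').trans_lt hF.2⟩
  have mρ : ∀ {F : ℝ × ℝ → ℝ}, MemLp F 2 volume → ∀ n, MemLp (mollify (ρ (ns n)) F) 2 volume :=
    fun hF n => ⟨((hρ _).contDiff_mollify (li hF)).continuous.aestronglyMeasurable,
      ((hρ _).eLpNorm_mollify_le hF.1 one_le_two' two_ne_top').trans_lt hF.2⟩
  have tk : ∀ {F : ℝ × ℝ → ℝ}, MemLp F 2 volume →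
      Tendsto (fun n => eLpNorm (mollify (k (ns n)) F - F) 2 volume) atTop (𝓝 0) := fun hF =>
    (IsMollifier.tendsto_eLpNorm_mollify_sub hk hcn hδ one_le_two' two_ne_top' hF).comp hnsT
  have tρ : ∀ {F : ℝ × ℝ → ℝ}, MemLp F 2 volume →
      Tendsto (fun n => eLpNorm (mollify (ρ (ns n)) F - F) 2 volume) atTop (𝓝 0) := fun hF =>
    (IsMollifier.tendsto_eLpNorm_mollify_sub hρ tendsto_const_nhds hδ one_le_two' two_ne_top'
      hF).comp hnsT
  have aA : ∀ᵐ z, Tendsto (fun n => mollify (ρ (ns n)) A z) atTop (𝓝 (A z)) := by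
    filter_upwards [lim₁] with z hz
    exact hz.comp hn₂.tendsto_atTop
  have cA : ∀ n, ContDiff ℝ ∞ (mollify (ρ (ns n)) A) := fun n =>
    (hρ _).contDiff_mollify (li h.memLp_A)
  have cV : ∀ n, ContDiff ℝ ∞ (mollify (k (ns n)) V) := fun n =>
    (hk _).contDiff_mollify (li h.memLp_V)
  have hζdx : IsTestFunction univ (dx ζ) := hζ.fderiv_apply (1, 0)
  have hζdy : IsTestFunction univ (dy ζ) := hζ.fderiv_apply (0, 1)
  obtain ⟨Z₀, hZ₀⟩ := hζ.exists_bound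
  obtain ⟨Z₁, hZ₁⟩ := hζdx.exists_bound
  obtain ⟨Z₂, hZ₂⟩ := hζdy.exists_bound
  set Z := max Z₀ (max Z₁ Z₂) with hZ
  have limit : ∀ {D E ζ' : ℝ × ℝ → ℝ}, MemLp E 2 volume → MemLp D 2 volume → Continuous ζ' →
      (∀ z, |ζ' z| ≤ Z) → _ := fun {D E ζ'} hE hD hc' hb' =>
    tendsto_integral_mul_deriv_quotient (ζ := ζ) (ζ' := ζ') h.pos (h.memLp_W hE hD) h.memLp_V hD hE
      (mk h.memLp_V) (mk hD) (mρ hE) (tk h.memLp_V) (tk hD) (tρ hE) lim₂ aA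
      (fun n => (cA n).continuous) (fun n => (cV n).continuous)
      (fun n => (hk _).abs_mollify_le (li h.memLp_V) h.abs_V_le) hζ.continuous hc'
      (fun z => (hZ₀ z).trans (le_max_left _ _)) hb'
  have key := (limit h.memLp_Ax h.memLp_Vx hζdx.continuous
    fun z => (hZ₁ z).trans ((le_max_left _ _).trans (le_max_right _ _))).add
    (limit h.memLp_Ay h.memLp_Vy hζdy.continuous
    fun z => (hZ₂ z).trans ((le_max_right _ _).trans (le_max_right _ _)))
  -- the approximating integrals vanish: they are the vorticity equation with a test function
  have hzero : ∀ᶠ n in atTop, ∫ z,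
      ((A z * Vx z - V z * Ax z) * (dx ζ z * mollify (k (ns n)) V z
          * truncInv c (mollify (ρ (ns n)) A z) + ζ z * (mollify (k (ns n)) Vx z
          * truncInv c (mollify (ρ (ns n)) A z) - mollify (k (ns n)) V z
          * mollify (ρ (ns n)) Ax z * truncInv c (mollify (ρ (ns n)) A z) ^ 2))
      + (A z * Vy z - V z * Ay z) * (dy ζ z * mollify (k (ns n)) V z
          * truncInv c (mollify (ρ (ns n)) A z) + ζ z * (mollify (k (ns n)) Vy z
          * truncInv c (mollify (ρ (ns n)) A z) - mollify (k (ns n)) V z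
          * mollify (ρ (ns n)) Ay z * truncInv c (mollify (ρ (ns n)) A z) ^ 2))) = 0 := by
    filter_upwards [(hδ.comp hnsT).eventually (gt_mem_nhds (lt_min hη hL))] with n hn
    set d := δ (ns n)
    have hdη : d < η := hn.trans_le (min_le_left _ _)
    have hdL : d < L := hn.trans_le (min_le_right _ _)
    have hd0 : 0 < d := hδ0 _
    set v := mollify (k (ns n)) V
    set α := mollify (ρ (ns n)) A
    have hkn := hk (ns n)
    have hρn := hρ (ns n)
    have hball : ∀ z ∈ tsupport ζ, z ∈ tsupport v → Metric.closedBall z d ⊆ window L a b :=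
      fun z hz hz' => closedBall_subset_window h.V_eq_zero hζx hζy hd0 hdη hdL hkn hz hz'
    have hα : ∀ z ∈ tsupport ζ, z ∈ tsupport v → c ≤ |α z| := by
      intro z hz hz'
      have h1 : c ≤ mollify (ρ (ns n)) (fun s => σ * A s) z := by
        refine hρn.le_mollify ((li h.memLp_A).smul σ) ?_
        filter_upwards [h.le_A] with s hs hmem
        rw [sub_zero] at hmem
        exact hs (hball z hz hz' hmem)
      rw [IsMollifier.mollify_const_mul] at h1
      have := h1.trans (le_abs_self _)
      rwa [abs_mul, h.abs_sign, one_mul] at this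
    have hα0 : ∀ z ∈ tsupport ζ, z ∈ tsupport v → α z ≠ 0 := fun z hz hz' =>
      abs_pos.1 (h.pos.trans_le (hα z hz hz'))
    have htest : IsTestFunction (window L a b) fun z => ζ z * (v z / α z) := by
      have hs1 : tsupport (fun z => ζ z * (v z / α z)) ⊆ tsupport ζ := tsupport_mul_subset_left
      have hs2 : tsupport (fun z => ζ z * (v z / α z)) ⊆ tsupport v := by
        refine closure_mono fun z hz => ?_
        by_contra h0
        exact hz (by simp [Function.notMem_support.1 h0])
      refine ⟨contDiff_mul_div hζ.smooth (cV n) (cA n) hα0, hζ.compact.mul_right, fun z hz => ?_⟩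
      exact hball z (hs1 hz) (hs2 hz) (Metric.mem_closedBall_self hd0.le)
    have hcol : ∀ z ∈ tsupport ζ,
        Metric.closedBall (z - (0, 3 * τ * d)) d ⊆ column L := by
      intro z hz s hs
      rw [mem_closedBall_iff_norm, Prod.norm_def, max_le_iff] at hs
      simp only [Prod.fst_sub, Real.norm_eq_abs, abs_le, sub_zero] at hs
      have hx := hζx z hz
      exact ⟨⟨by linarith [hx.1, hs.1.1], by linarith [hx.2, hs.1.2]⟩, mem_univ _⟩
    have hder : ∀ {e : ℝ × ℝ} {D E : ℝ × ℝ → ℝ}, HasWeakDeriv (column L) e V D →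
        HasWeakDeriv (window L a b) e A E → ∀ z, fderiv ℝ (fun z => ζ z * (v z / α z)) z e
          = fderiv ℝ ζ z e * v z * truncInv c (α z) + ζ z * (mollify (k (ns n)) D z
            * truncInv c (α z) - v z * mollify (ρ (ns n)) E z * truncInv c (α z) ^ 2) := by
      intro e D E hD hE z
      by_cases hz : z ∈ tsupport ζ
      · have hvD := hkn.fderiv_mollify hD (hcol z hz)
        by_cases hz' : z ∈ tsupport v
        · rw [fderiv_mul_div_of_mem hζ.smooth (cV n) (cA n) (hα0 z hz hz'),
            truncInv_eq_inv h.pos (hα z hz hz'), hvD,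
            hρn.fderiv_mollify hE (by rw [sub_zero]; exact hball z hz hz')]
        · rw [fderiv_mul_div_of_notMem α (Or.inr hz'), ← hvD,
            image_eq_zero_of_notMem_tsupport hz',
            show fderiv ℝ (mollify (k (ns n)) V) z = 0 from
              fderiv_of_notMem_tsupport ℝ hz']
          simp
      · rw [fderiv_mul_div_of_notMem α (Or.inl hz), image_eq_zero_of_notMem_tsupport hz,
          fderiv_of_notMem_tsupport ℝ hz]
        simp
    have := h.vorticity _ htest
    simp only [dx, dy, hder h.weak_Vx h.weak_Ax, hder h.weak_Vy h.weak_Ay] at this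
    exact this
  have hlim0 := tendsto_nhds_unique key.tendsto (tendsto_const_nhds.congr' (hzero.mono
    fun n hn => hn.symm))
  have hae : (fun z => (A z * Vx z - V z * Ax z) * (dx ζ z * V z * truncInv c (A z)
        + ζ z * (Vx z * truncInv c (A z) - V z * Ax z * truncInv c (A z) ^ 2))
      + (A z * Vy z - V z * Ay z) * (dy ζ z * V z * truncInv c (A z)
        + ζ z * (Vy z * truncInv c (A z) - V z * Ay z * truncInv c (A z) ^ 2))) =ᵐ[volume]
      fun z => ζ z * (((A z * Vx z - V z * Ax z) ^ 2 + (A z * Vy z - V z * Ay z) ^ 2)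
          * (A z)⁻¹ ^ 2)
        + ((A z * Vx z - V z * Ax z) * V z * (A z)⁻¹ * dx ζ z
          + (A z * Vy z - V z * Ay z) * V z * (A z)⁻¹ * dy ζ z) := by
    filter_upwards [h.le_abs_A] with z hz
    by_cases hmem : z ∈ window L a b
    · have h0 : A z ≠ 0 := abs_pos.1 (h.pos.trans_le (hz hmem))
      rw [truncInv_eq_inv h.pos (hz hmem)]
      field_simp
      ring
    · simp [h.A_eq_zero z hmem, h.V_eq_zero z hmem]
  exact ⟨key.integrable.congr hae, by rw [← integral_congr_ae hae, hlim0]⟩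

end WindowFlow

/-! ### Cutoff functions -/

/-- A smooth bump on `[-L, L]` whose translates by multiples of `L` form a partition of unity. -/
noncomputable def periodCutoff (L x : ℝ) : ℝ :=
  Real.smoothTransition (x / L + 1) - Real.smoothTransition (x / L)

section periodCutoff

variable {L : ℝ}

theorem contDiff_periodCutoff : ContDiff ℝ ∞ (periodCutoff L) :=
  (Real.smoothTransition.contDiff.comp (by fun_prop)).sub
    (Real.smoothTransition.contDiff.comp (by fun_prop))

theorem periodCutoff_nonneg (hL : 0 < L) (x : ℝ) : 0 ≤ periodCutoff L x := by
  rcases le_total x 0 with h | h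
  · have : x / L ≤ 0 := div_nonpos_of_nonpos_of_nonneg h hL.le
    simp [periodCutoff, Real.smoothTransition.zero_of_nonpos this,
      Real.smoothTransition.nonneg]
  · have : 1 ≤ x / L + 1 := by have := div_nonneg h hL.le; linarith
    simp [periodCutoff, Real.smoothTransition.one_of_one_le this, Real.smoothTransition.le_one]

theorem periodCutoff_pos (hL : 0 < L) {x : ℝ} (hx : x ∈ Ioo (-L) L) : 0 < periodCutoff L x := by
  rcases le_total x 0 with h | h
  · have h1 : x / L ≤ 0 := div_nonpos_of_nonpos_of_nonneg h hL.le
    have h2 : 0 < x / L + 1 := by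
      have : -1 < x / L := by rw [lt_div_iff₀ hL]; linarith [hx.1]
      linarith
    simpa [periodCutoff, Real.smoothTransition.zero_of_nonpos h1] using
      Real.smoothTransition.pos_of_pos h2
  · have h1 : 1 ≤ x / L + 1 := by have := div_nonneg h hL.le; linarith
    have h2 : x / L < 1 := by rw [div_lt_one hL]; exact hx.2
    simpa [periodCutoff, Real.smoothTransition.one_of_one_le h1] using
      Real.smoothTransition.lt_one_of_lt_one h2

theorem periodCutoff_eq_zero (hL : 0 < L) {x : ℝ} (hx : x ∉ Ioo (-L) L) :
    periodCutoff L x = 0 := by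
  rcases le_or_gt x (-L) with h | h
  · have h1 : x / L ≤ -1 := by rw [div_le_iff₀ hL]; linarith
    simp [periodCutoff, Real.smoothTransition.zero_of_nonpos (by linarith : x / L ≤ 0),
      Real.smoothTransition.zero_of_nonpos (by linarith : x / L + 1 ≤ 0)]
  · have h1 : 1 ≤ x / L := by
      rw [le_div_iff₀ hL]
      by_contra hcon
      exact hx ⟨h, by linarith⟩
    simp [periodCutoff, Real.smoothTransition.one_of_one_le h1,
      Real.smoothTransition.one_of_one_le (by linarith : 1 ≤ x / L + 1)]

theorem tsupport_periodCutoff_subset (hL : 0 < L) : tsupport (periodCutoff L) ⊆ Icc (-L) L :=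
  closure_minimal (fun x hx => by
    by_contra h
    exact hx (periodCutoff_eq_zero hL fun h' => h (Ioo_subset_Icc_self h'))) isClosed_Icc

theorem hasCompactSupport_periodCutoff (hL : 0 < L) : HasCompactSupport (periodCutoff L) :=
  isCompact_Icc.of_isClosed_subset (isClosed_tsupport _) (tsupport_periodCutoff_subset hL)

/-- Since the translates of the cutoff sum to a constant, the integral of `q` against its
derivative telescopes to zero when `q` is periodic. -/
theorem integral_deriv_periodCutoff_mul (hL : 0 < L) {q : ℝ × ℝ → ℝ} (hq : Integrable q)
    (hper : ∀ᵐ z : ℝ × ℝ, z.1 ∈ Ioo (-(2 * L)) L → q (z + (L, 0)) = q z) :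
    Integrable (fun z => deriv (periodCutoff L) z.1 * q z) ∧
      ∫ z, deriv (periodCutoff L) z.1 * q z = 0 := by
  set s : ℝ → ℝ := fun x => Real.smoothTransition (x / L) with hs
  have hsd : ContDiff ℝ ∞ s := Real.smoothTransition.contDiff.comp (by fun_prop)
  have hs' : ∀ x ∉ Icc 0 L, deriv s x = 0 := by
    intro x hx
    rcases lt_or_ge x 0 with h | h
    · have : s =ᶠ[𝓝 x] fun _ => 0 := by
        filter_upwards [Iio_mem_nhds h] with y hy
        exact Real.smoothTransition.zero_of_nonpos
          (div_nonpos_of_nonpos_of_nonneg (le_of_lt hy) hL.le)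
      rw [this.deriv_eq, deriv_const]
    · have hx' : L < x := not_le.1 fun h' => hx ⟨h, h'⟩
      have : s =ᶠ[𝓝 x] fun _ => 1 := by
        filter_upwards [Ioi_mem_nhds hx'] with y hy
        exact Real.smoothTransition.one_of_one_le ((one_le_div hL).2 (le_of_lt hy))
      rw [this.deriv_eq, deriv_const]
  have hcont : Continuous (deriv s) := hsd.continuous_deriv (by simp)
  obtain ⟨C, hC⟩ := hcont.bounded_above_of_compact_support
    (HasCompactSupport.intro isCompact_Icc hs')
  have hχ : ∀ x, deriv (periodCutoff L) x = deriv s (x + L) - deriv s x := by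
    intro x
    have h1 : periodCutoff L = fun x => s (x + L) - s x := by
      ext x
      simp only [periodCutoff, hs]
      congr 2
      field_simp
    rw [h1, deriv_fun_sub, deriv_comp_add_const]
    · exact ((hsd.differentiable (by simp)).comp (by fun_prop)) x
    · exact hsd.differentiable (by simp) x
  have i1 : Integrable fun z => deriv s z.1 * q z :=
    hq.bdd_mul (hcont.comp continuous_fst).aestronglyMeasurable (ae_of_all _ fun z => hC z.1)
  have i2 : Integrable fun z => deriv s (z.1 + L) * q z :=
    hq.bdd_mul (hcont.comp (by fun_prop)).aestronglyMeasurable (ae_of_all _ fun z => hC _)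
  have e : ∫ z, deriv s (z.1 + L) * q z = ∫ z, deriv s z.1 * q z := by
    rw [← integral_add_right_eq_self (fun z => deriv s z.1 * q z) ((L, 0) : ℝ × ℝ)]
    refine integral_congr_ae ?_
    filter_upwards [hper] with z hz
    simp only [Prod.fst_add]
    by_cases h : z.1 + L ∈ Icc 0 L
    · rw [hz ⟨by linarith [h.1], by linarith [h.2]⟩]
    · simp [hs' _ h]
  simp only [hχ, sub_mul]
  exact ⟨i2.sub i1, by rw [integral_sub i2 i1, e, sub_self]⟩

/-- The test function `χ(x) θ(y)`, where `χ` is the period cutoff, and its partial derivatives. -/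
theorem isTestFunction_periodCutoff_mul (hL : 0 < L) {θ : ℝ → ℝ} (hθ : ContDiff ℝ ∞ θ)
    (hθc : HasCompactSupport θ) :
    IsTestFunction (column L) (fun z => periodCutoff L z.1 * θ z.2) ∧
    (∀ z ∈ tsupport fun z : ℝ × ℝ => periodCutoff L z.1 * θ z.2,
      z.1 ∈ Icc (-L) L ∧ z.2 ∈ tsupport θ) ∧
    (∀ z, dx (fun z => periodCutoff L z.1 * θ z.2) z = deriv (periodCutoff L) z.1 * θ z.2) ∧
    ∀ z, dy (fun z => periodCutoff L z.1 * θ z.2) z = periodCutoff L z.1 * deriv θ z.2 := by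
  have hsub : tsupport (fun z : ℝ × ℝ => periodCutoff L z.1 * θ z.2)
      ⊆ tsupport (periodCutoff L) ×ˢ tsupport θ := by
    refine closure_minimal (fun z hz => ?_)
      ((isClosed_tsupport _).prod (isClosed_tsupport _))
    exact ⟨subset_tsupport _ (left_ne_zero_of_mul hz), subset_tsupport _ (right_ne_zero_of_mul hz)⟩
  have hsub' := tsupport_periodCutoff_subset hL
  have hd : ∀ z : ℝ × ℝ, HasFDerivAt (fun z : ℝ × ℝ => periodCutoff L z.1 * θ z.2)
      (periodCutoff L z.1 • (deriv θ z.2 • ContinuousLinearMap.snd ℝ ℝ ℝ)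
        + θ z.2 • (deriv (periodCutoff L) z.1 • ContinuousLinearMap.fst ℝ ℝ ℝ)) z := fun z =>
    (((contDiff_periodCutoff.differentiable (by simp) z.1).hasDerivAt).comp_hasFDerivAt z
      hasFDerivAt_fst).mul
    (((hθ.differentiable (by simp) z.2).hasDerivAt).comp_hasFDerivAt z hasFDerivAt_snd)
  refine ⟨⟨(contDiff_periodCutoff.comp contDiff_fst).mul (hθ.comp contDiff_snd), ?_, ?_⟩,
    fun z hz => ⟨hsub' (hsub hz).1, (hsub hz).2⟩, fun z => ?_, fun z => ?_⟩
  · exact ((hasCompactSupport_periodCutoff hL).prod hθc).of_isClosed_subset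
      (isClosed_tsupport _) hsub
  · intro z hz
    have := hsub' (hsub hz).1
    exact ⟨⟨by linarith [this.1], by linarith [this.2]⟩, mem_univ _⟩
  · rw [dx, (hd z).fderiv]
    simp [mul_comm]
  · rw [dy, (hd z).fderiv]
    simp

end periodCutoff

theorem exists_cutoff_one_on (a b : ℝ) (hab : a < b) :
    ∃ κ : ℝ → ℝ, ContDiff ℝ ∞ κ ∧ HasCompactSupport κ ∧ (∀ y ∈ Ioo a b, κ y = 1) ∧
      ∀ y ∈ Ioo a b, deriv κ y = 0 := by
  let f : ContDiffBump ((a + b) / 2) := ⟨(b - a) / 2, b - a, by linarith, by linarith⟩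
  have h1 : ∀ y ∈ Ioo a b, f y = 1 := fun y hy => by
    refine f.one_of_mem_closedBall ?_
    rw [Real.closedBall_eq_Icc]
    constructor <;> simp only [f] <;> linarith [hy.1, hy.2]
  refine ⟨f, f.contDiff, f.hasCompactSupport, h1, fun y hy => ?_⟩
  have : (f : ℝ → ℝ) =ᶠ[𝓝 y] fun _ => 1 := by
    filter_upwards [isOpen_Ioo.mem_nhds hy] with t ht
    exact h1 t ht
  rw [this.deriv_eq, deriv_const]

/-! ### Rigidity in the window -/

namespace WindowFlow

variable {L a b σ c M : ℝ} {A V Ax Ay Vx Vy : ℝ × ℝ → ℝ}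

/-- The energy identity summed over two cutoffs that add up to `1` on `(a, b)`, each of
which vanishes near one wall. The remaining `x`-derivative of the cutoff telescopes, so
`∇(V / A)` vanishes; stated for `W = A² ∇(V / A)`. -/
theorem ae_W_eq_zero (h : WindowFlow L a b σ c M A V Ax Ay Vx Vy) (hL : 0 < L) (hab : a < b) :
    ∀ᵐ z : ℝ × ℝ, z.1 ∈ Ioo (-L) L →
      A z * Vx z - V z * Ax z = 0 ∧ A z * Vy z - V z * Ay z = 0 := by
  obtain ⟨κ, hκ, hκc, hκ1, hκ'⟩ := exists_cutoff_one_on a b hab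
  set η := (b - a) / 4 with hη
  have hη0 : 0 < η := by rw [hη]; linarith
  -- `B` rises from `0` at `a + η` to `1` at `b - η`
  set B : ℝ → ℝ := fun y => Real.smoothTransition ((y - a - η) / (2 * η)) with hB
  have hBs : ContDiff ℝ ∞ B := Real.smoothTransition.contDiff.comp (by fun_prop)
  have hup : ∀ y ∈ tsupport (fun y => κ y * B y), a + η ≤ y := by
    intro y hy
    have : tsupport (fun y => κ y * B y) ⊆ Ici (a + η) := by
      refine closure_minimal (fun t ht => ?_) isClosed_Ici
      by_contra hlt
      refine right_ne_zero_of_mul ht (Real.smoothTransition.zero_of_nonpos ?_)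
      have hlt' : t < a + η := not_le.1 hlt
      exact div_nonpos_of_nonpos_of_nonneg (by linarith) (by linarith)
    exact this hy
  have hlow : ∀ y ∈ tsupport (fun y => κ y * (1 - B y)), y ≤ b - η := by
    intro y hy
    have : tsupport (fun y => κ y * (1 - B y)) ⊆ Iic (b - η) := by
      refine closure_minimal (fun t ht => ?_) isClosed_Iic
      by_contra hlt
      refine right_ne_zero_of_mul ht (sub_eq_zero.2 (Eq.symm ?_))
      refine Real.smoothTransition.one_of_one_le ((one_le_div (by linarith)).2 ?_)
      have hlt' : b - η < t := not_le.1 hlt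
      linarith
    exact this hy
  have s1 : ContDiff ℝ ∞ fun y => κ y * (1 - B y) := hκ.mul (contDiff_const.sub hBs)
  have s2 : ContDiff ℝ ∞ fun y => κ y * B y := hκ.mul hBs
  obtain ⟨t1, u1, dx1, dy1⟩ := isTestFunction_periodCutoff_mul hL s1 hκc.mul_right
  obtain ⟨t2, u2, dx2, dy2⟩ := isTestFunction_periodCutoff_mul hL s2 hκc.mul_right
  obtain ⟨i1, e1⟩ := h.energy_identity_of_cutoff hL (t1.mono (subset_univ _)) hη0
    (fun z hz => (u1 z hz).1) (Or.inl ⟨rfl, fun z hz => hlow _ (u1 z hz).2⟩)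
  obtain ⟨i2, e2⟩ := h.energy_identity_of_cutoff hL (t2.mono (subset_univ _)) hη0
    (fun z hz => (u2 z hz).1) (Or.inr ⟨rfl, fun z hz => hup _ (u2 z hz).2⟩)
  simp only [dx1, dy1, dx2, dy2] at i1 e1 i2 e2
  set p : ℝ × ℝ → ℝ := fun z =>
    ((A z * Vx z - V z * Ax z) ^ 2 + (A z * Vy z - V z * Ay z) ^ 2) * (A z)⁻¹ ^ 2 with hp
  set q : ℝ × ℝ → ℝ := fun z => (A z * Vx z - V z * Ax z) * V z * (A z)⁻¹ with hq
  have hder : ∀ y ∈ Ioo a b,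
      deriv (fun y => κ y * (1 - B y)) y + deriv (fun y => κ y * B y) y = 0 := by
    intro y hy
    rw [← deriv_fun_add (s1.differentiable (by simp) y) (s2.differentiable (by simp) y), ← hκ' y hy]
    congr 1
    ext t
    ring
  have hsum : ∀ z : ℝ × ℝ,
      (periodCutoff L z.1 * (κ z.2 * (1 - B z.2)) * p z
        + (q z * (deriv (periodCutoff L) z.1 * (κ z.2 * (1 - B z.2)))
          + (A z * Vy z - V z * Ay z) * V z * (A z)⁻¹
            * (periodCutoff L z.1 * deriv (fun y => κ y * (1 - B y)) z.2)))
      + (periodCutoff L z.1 * (κ z.2 * B z.2) * p z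
        + (q z * (deriv (periodCutoff L) z.1 * (κ z.2 * B z.2))
          + (A z * Vy z - V z * Ay z) * V z * (A z)⁻¹
            * (periodCutoff L z.1 * deriv (fun y => κ y * B y) z.2)))
      = periodCutoff L z.1 * p z + deriv (periodCutoff L) z.1 * q z := by
    intro z
    by_cases hz : z ∈ window L a b
    · have h1 := hκ1 _ hz.2
      have h2 := hder _ hz.2
      rw [h1]
      linear_combination ((A z * Vy z - V z * Ay z) * V z * (A z)⁻¹ * periodCutoff L z.1) * h2
    · simp [hp, hq, h.A_eq_zero z hz, h.V_eq_zero z hz]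
  have hiq : Integrable q := by
    have h1 : Integrable fun z => (A z * Vx z - V z * Ax z) * V z :=
      (h.memLp_W h.memLp_Ax h.memLp_Vx).integrable_mul h.memLp_V
    refine h1.mul_bdd (c := 1 / c) h.memLp_A.1.aemeasurable.inv.aestronglyMeasurable ?_
    filter_upwards [h.le_abs_A] with z hz
    by_cases hmem : z ∈ window L a b
    · rw [norm_inv, one_div]
      exact inv_anti₀ h.pos (hz hmem)
    · simp [h.A_eq_zero z hmem, h.pos.le]
  obtain ⟨i3, e3⟩ := integral_deriv_periodCutoff_mul hL hiq (by
    filter_upwards [h.periodic] with z hz hmem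
    obtain ⟨p1, p2, p3, p4⟩ := hz hmem
    simp only [hq, p1, p2, p3, p4])
  have i4 := i1.add i2
  have e4 := integral_add i1 i2
  rw [e1, e2, add_zero] at e4
  have i5 : Integrable fun z => periodCutoff L z.1 * p z := by
    refine (i4.sub i3).congr (ae_of_all _ fun z => ?_)
    have := hsum z
    simp only [Pi.sub_apply, Pi.add_apply]
    linarith
  have e5 : ∫ z, periodCutoff L z.1 * p z = 0 := by
    rw [integral_congr_ae (ae_of_all _ hsum), integral_add i5 i3, e3, add_zero] at e4
    exact e4
  have hnn : ∀ z : ℝ × ℝ, 0 ≤ periodCutoff L z.1 * p z := fun z =>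
    mul_nonneg (periodCutoff_nonneg hL _) (by positivity)
  have h0 := (integral_eq_zero_iff_of_nonneg hnn i5).1 e5
  filter_upwards [h0, h.le_abs_A] with z hz hA hmem
  by_cases hzw : z ∈ window L a b
  · have hA0 : (A z)⁻¹ ^ 2 ≠ 0 := by
      have : A z ≠ 0 := abs_pos.1 (h.pos.trans_le (hA hzw))
      positivity
    have h1 : (A z * Vx z - V z * Ax z) ^ 2 + (A z * Vy z - V z * Ay z) ^ 2 = 0 := by
      have h2 := (mul_eq_zero.1 hz).resolve_left (periodCutoff_pos hL hmem).ne'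
      exact (mul_eq_zero.1 h2).resolve_right hA0
    constructor <;> nlinarith [sq_nonneg (A z * Vx z - V z * Ax z),
      sq_nonneg (A z * Vy z - V z * Ay z)]
  · simp [h.A_eq_zero z hzw, h.V_eq_zero z hzw]

/-- Tangency at the walls tested with `V ζ`, for which `V` is mollified. -/
theorem integral_tangent_mul (h : WindowFlow L a b σ c M A V Ax Ay Vx Vy) (hL : 0 < L)
    {ζ : ℝ × ℝ → ℝ} (hζ : IsTestFunction univ ζ) (hζx : ∀ z ∈ tsupport ζ, z.1 ∈ Icc (-L) L) :
    Integrable (fun z => A z * (Vx z * ζ z) + A z * (V z * dx ζ z)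
      + (V z * (Vy z * ζ z) + V z * (V z * dy ζ z))) ∧
    ∫ z, (A z * (Vx z * ζ z) + A z * (V z * dx ζ z)
      + (V z * (Vy z * ζ z) + V z * (V z * dy ζ z))) = 0 := by
  set δ : ℕ → ℝ := fun n => 1 / ((n : ℝ) + 1) with hδdef
  have hδ : Tendsto δ atTop (𝓝 0) := tendsto_one_div_add_atTop_nhds_zero_nat
  choose ρ hρ using fun n : ℕ => exists_isMollifier 0 (show 0 < δ n by positivity)
  have one_le_two' : (1 : ℝ≥0∞) ≤ 2 := by norm_num
  have two_ne_top' : (2 : ℝ≥0∞) ≠ ⊤ := by norm_num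
  have li : ∀ {F : ℝ × ℝ → ℝ}, MemLp F 2 volume → LocallyIntegrable F :=
    fun hF => hF.locallyIntegrable one_le_two'
  have mρ : ∀ {F : ℝ × ℝ → ℝ}, MemLp F 2 volume → ∀ n, MemLp (mollify (ρ n) F) 2 volume :=
    fun hF n => ⟨((hρ _).contDiff_mollify (li hF)).continuous.aestronglyMeasurable,
      ((hρ _).eLpNorm_mollify_le hF.1 one_le_two' two_ne_top').trans_lt hF.2⟩
  have tρ : ∀ {F : ℝ × ℝ → ℝ}, MemLp F 2 volume →
      Tendsto (fun n => eLpNorm (mollify (ρ n) F - F) 2 volume) atTop (𝓝 0) := fun hF =>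
    IsMollifier.tendsto_eLpNorm_mollify_sub hρ tendsto_const_nhds hδ one_le_two' two_ne_top' hF
  have hζdx : IsTestFunction univ (dx ζ) := hζ.fderiv_apply (1, 0)
  have hζdy : IsTestFunction univ (dy ζ) := hζ.fderiv_apply (0, 1)
  have lim : ∀ {w X Y : ℝ × ℝ → ℝ}, MemLp w 2 volume → MemLp X 2 volume →
      IsTestFunction univ Y →
      TendstoIntegral (fun n z => w z * (mollify (ρ n) X z * Y z)) (fun z => w z * (X z * Y z)) :=
    fun {w X Y} hw hX hY => tendsto_integral_mul_mul hw hX (mρ hX) (tρ hX)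
      (fun _ => hY.continuous.aestronglyMeasurable) (fun _ => hY.exists_bound.choose_spec)
      (ae_of_all _ fun z => tendsto_const_nhds)
  have key := ((lim h.memLp_A h.memLp_Vx hζ).add (lim h.memLp_A h.memLp_V hζdx)).add
    ((lim h.memLp_V h.memLp_Vy hζ).add (lim h.memLp_V h.memLp_V hζdy))
  refine ⟨key.integrable, tendsto_nhds_unique key.tendsto (tendsto_const_nhds.congr' ?_)⟩
  filter_upwards [hδ.eventually (gt_mem_nhds hL)] with n hn
  have hρn := hρ n
  have hcol : ∀ z ∈ tsupport ζ, Metric.closedBall (z - 0) (δ n) ⊆ column L := by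
    intro z hz s hs
    rw [mem_closedBall_iff_norm, Prod.norm_def, max_le_iff] at hs
    simp only [Prod.fst_sub, Real.norm_eq_abs, abs_le, sub_zero] at hs
    have hx := hζx z hz
    exact ⟨⟨by linarith [hx.1, hs.1.1], by linarith [hx.2, hs.1.2]⟩, mem_univ _⟩
  have hv := hρn.contDiff_mollify (li h.memLp_V)
  have htest : IsTestFunction (column L) fun z => mollify (ρ n) V z * ζ z := by
    have h1 := hζ.mul_left hv
    refine ⟨h1.smooth, h1.compact, fun z hz => ?_⟩
    have hx := hζx z (tsupport_mul_subset_right hz)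
    exact ⟨⟨by linarith [hx.1], by linarith [hx.2]⟩, mem_univ _⟩
  have hder : ∀ {e : ℝ × ℝ} {D : ℝ × ℝ → ℝ}, HasWeakDeriv (column L) e V D → ∀ z,
      fderiv ℝ (fun z => mollify (ρ n) V z * ζ z) z e
        = mollify (ρ n) D z * ζ z + mollify (ρ n) V z * fderiv ℝ ζ z e := by
    intro e D hD z
    have h1 := ((hv.differentiable (by simp) z).hasFDerivAt).mul
      ((hζ.smooth.differentiable (by simp) z).hasFDerivAt)
    have h2 : HasFDerivAt (fun z => mollify (ρ n) V z * ζ z) _ z := h1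
    rw [h2.fderiv]
    simp only [add_apply, smul_apply, smul_eq_mul]
    by_cases hz : z ∈ tsupport ζ
    · rw [hρn.fderiv_mollify hD (hcol z hz)]
      ring
    · rw [image_eq_zero_of_notMem_tsupport hz]
      ring
  have h0 := h.tangent _ htest
  simp only [dx, dy, hder h.weak_Vx, hder h.weak_Vy] at h0
  rw [← h0]
  congr 1
  ext z
  simp only [dx, dy]
  ring

/-- By incompressibility the terms with derivatives of `V` in the tangency identity add up to
`ζ W₁`, which vanishes, and the choice `ζ = χ(x) y` leaves `∫ χ V² = 0`. -/
theorem ae_V_eq_zero (h : WindowFlow L a b σ c M A V Ax Ay Vx Vy) (hL : 0 < L) (hab : a < b) :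
    ∀ᵐ z : ℝ × ℝ, z.1 ∈ Ioo (-L) L → V z = 0 := by
  obtain ⟨κ, hκ, hκc, hκ1, hκ'⟩ := exists_cutoff_one_on a b hab
  have s1 : ContDiff ℝ ∞ fun y => y * κ y := contDiff_id.mul hκ
  obtain ⟨t1, u1, dx1, dy1⟩ := isTestFunction_periodCutoff_mul hL s1 hκc.mul_left
  obtain ⟨i1, e1⟩ := h.integral_tangent_mul hL (t1.mono (subset_univ _)) fun z hz => (u1 z hz).1
  simp only [dx1, dy1] at i1 e1
  have hder : ∀ y ∈ Ioo a b, deriv (fun y => y * κ y) y = 1 := by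
    intro y hy
    have h1 := (hasDerivAt_id y).mul (hκ.differentiable (by simp) y).hasDerivAt
    have h2 : HasDerivAt (fun y => y * κ y) _ y := h1
    rw [h2.deriv, hκ1 y hy, hκ' y hy]
    simp
  set q : ℝ × ℝ → ℝ := fun z => z.2 * κ z.2 * (A z * V z) with hq
  have hsum : (fun z => A z * (Vx z * (periodCutoff L z.1 * (z.2 * κ z.2)))
        + A z * (V z * (deriv (periodCutoff L) z.1 * (z.2 * κ z.2)))
        + (V z * (Vy z * (periodCutoff L z.1 * (z.2 * κ z.2)))
        + V z * (V z * (periodCutoff L z.1 * deriv (fun y => y * κ y) z.2)))) =ᵐ[volume]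
      fun z => periodCutoff L z.1 * V z ^ 2 + deriv (periodCutoff L) z.1 * q z := by
    filter_upwards [h.ae_W_eq_zero hL hab, h.div_eq_zero] with z hW hdiv
    have h1 : periodCutoff L z.1 * (A z * Vx z + V z * Vy z) = 0 := by
      by_cases hz : z.1 ∈ Ioo (-L) L
      · have h2 := (hW hz).1
        rw [show Vy z = -Ax z by linarith]
        linear_combination periodCutoff L z.1 * h2
      · simp [periodCutoff_eq_zero hL hz]
    have h3 : V z * deriv (fun y => y * κ y) z.2 = V z := by
      by_cases hz : z ∈ window L a b
      · rw [hder _ hz.2, mul_one]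
      · simp [h.V_eq_zero z hz]
    simp only [hq]
    linear_combination z.2 * κ z.2 * h1 + V z * periodCutoff L z.1 * h3
  have hiq : Integrable q := by
    obtain ⟨C, hC⟩ := s1.continuous.bounded_above_of_compact_support hκc.mul_left
    refine (h.memLp_A.integrable_mul h.memLp_V).bdd_mul (c := C)
      (s1.continuous.comp continuous_snd).aestronglyMeasurable (ae_of_all _ fun z => hC z.2)
  obtain ⟨i3, e3⟩ := integral_deriv_periodCutoff_mul hL hiq (by
    filter_upwards [h.periodic] with z hz hmem
    obtain ⟨p1, p2, -, -⟩ := hz hmem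
    simp [hq, p1, p2])
  have i4 := i1.congr hsum
  rw [integral_congr_ae hsum] at e1
  have i5 : Integrable fun z => periodCutoff L z.1 * V z ^ 2 := by
    refine (i4.sub i3).congr (ae_of_all _ fun z => ?_)
    simp
  rw [integral_add i5 i3, e3, add_zero] at e1
  have hnn : ∀ z : ℝ × ℝ, 0 ≤ periodCutoff L z.1 * V z ^ 2 := fun z =>
    mul_nonneg (periodCutoff_nonneg hL _) (by positivity)
  filter_upwards [(integral_eq_zero_iff_of_nonneg hnn i5).1 e1] with z hz hmem
  have h2 := (mul_eq_zero.1 hz).resolve_left (periodCutoff_pos hL hmem).ne'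
  exact pow_eq_zero_iff (two_ne_zero) |>.1 h2

end WindowFlow

/-! ### Extension across the walls -/

/-- A weak `x`-derivative in the window is a weak `x`-derivative in the column for the
extensions by zero: cutoffs in `y` do not interfere with `∂ₓ`. -/
theorem HasWeakDeriv.column_of_window {L a b : ℝ} {F G : ℝ × ℝ → ℝ}
    (h : HasWeakDeriv (window L a b) (1, 0) F G) (hF : ∀ z ∉ window L a b, F z = 0)
    (hG : ∀ z ∉ window L a b, G z = 0) : HasWeakDeriv (column L) (1, 0) F G := by
  refine ⟨h.locInt, h.locInt_deriv, fun φ hφ => ?_⟩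
  -- the cutoffs `η n` vanish near the walls and converge to the indicator function of `(a, b)`
  set S := Real.smoothTransition
  set η : ℕ → ℝ → ℝ := fun n y => S ((n + 1) * (y - a) - 1) * S ((n + 1) * (b - y) - 1) with hη
  have hηs : ∀ n, ContDiff ℝ ∞ (η n) := fun n =>
    (Real.smoothTransition.contDiff.comp (by fun_prop)).mul
      (Real.smoothTransition.contDiff.comp (by fun_prop))
  have hη1 : ∀ n y, |η n y| ≤ 1 := fun n y => by
    rw [abs_of_nonneg (mul_nonneg (Real.smoothTransition.nonneg _)
      (Real.smoothTransition.nonneg _))]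
    exact mul_le_one₀ (Real.smoothTransition.le_one _) (Real.smoothTransition.nonneg _)
      (Real.smoothTransition.le_one _)
  have hηlim : ∀ y ∈ Ioo a b, Tendsto (fun n => η n y) atTop (𝓝 1) := by
    intro y hy
    have hn : Tendsto (fun n : ℕ => (n : ℝ) + 1) atTop atTop :=
      tendsto_atTop_add_const_right _ _ tendsto_natCast_atTop_atTop
    have e1 := (hn.atTop_mul_const (sub_pos.2 hy.1)).eventually_ge_atTop 2
    have e2 := (hn.atTop_mul_const (sub_pos.2 hy.2)).eventually_ge_atTop 2
    refine tendsto_const_nhds.congr' ?_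
    filter_upwards [e1, e2] with n h1 h2
    simp only [hη, S]
    rw [Real.smoothTransition.one_of_one_le (by linarith),
      Real.smoothTransition.one_of_one_le (by linarith), mul_one]
  have htest : ∀ n, IsTestFunction (window L a b) fun z => η n z.2 * φ z := by
    intro n
    have h1 := hφ.mul_left ((hηs n).comp contDiff_snd)
    refine ⟨h1.smooth, h1.compact, fun z hz => ⟨(h1.support hz).1, ?_⟩⟩
    have hpos : (0 : ℝ) < (n : ℝ) + 1 := by positivity
    have hsub : tsupport (fun z : ℝ × ℝ => η n z.2 * φ z)
        ⊆ {z | 1 ≤ (n + 1) * (z.2 - a)} ∩ {z | 1 ≤ (n + 1) * (b - z.2)} := by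
      refine closure_minimal (fun w hw => ?_) (IsClosed.inter
        (isClosed_le continuous_const (by fun_prop)) (isClosed_le continuous_const (by fun_prop)))
      have hw' := left_ne_zero_of_mul hw
      constructor
      · by_contra hlt
        refine left_ne_zero_of_mul hw' (Real.smoothTransition.zero_of_nonpos ?_)
        linarith [not_le.1 (show ¬ 1 ≤ (n + 1) * (w.2 - a) from hlt)]
      · by_contra hlt
        refine right_ne_zero_of_mul hw' (Real.smoothTransition.zero_of_nonpos ?_)
        linarith [not_le.1 (show ¬ 1 ≤ (n + 1) * (b - w.2) from hlt)]
    obtain ⟨h2, h3⟩ := hsub hz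
    have h2' : 0 < (n + 1) * (z.2 - a) := lt_of_lt_of_le one_pos h2
    have h3' : 0 < (n + 1) * (b - z.2) := lt_of_lt_of_le one_pos h3
    exact ⟨sub_pos.1 ((mul_pos_iff_of_pos_left hpos).1 h2'),
      sub_pos.1 ((mul_pos_iff_of_pos_left hpos).1 h3')⟩
  have hder : ∀ n z, fderiv ℝ (fun z => η n z.2 * φ z) z (1, 0)
      = η n z.2 * fderiv ℝ φ z (1, 0) := by
    intro n z
    have h1 := (((hηs n).differentiable (by simp) z.2).hasDerivAt.comp_hasFDerivAt z
      hasFDerivAt_snd).mul ((hφ.smooth.differentiable (by simp) z).hasFDerivAt)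
    have h2 : HasFDerivAt (fun z => η n z.2 * φ z) _ z := h1
    rw [h2.fderiv]
    simp
  have hlim : ∀ {H ψ : ℝ × ℝ → ℝ}, LocallyIntegrable H → (∀ z ∉ window L a b, H z = 0) →
      IsTestFunction (column L) ψ →
      Tendsto (fun n => ∫ z, H z * (η n z.2 * ψ z)) atTop (𝓝 (∫ z, H z * ψ z)) := by
    intro H ψ hH hH0 hψ
    have hi := hψ.integrable_mul hH
    refine tendsto_integral_of_dominated_convergence (fun z => ‖H z * ψ z‖) (fun n => ?_) hi.norm
      (fun n => ae_of_all _ fun z => ?_) (ae_of_all _ fun z => ?_)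
    · have := hi.1.mul ((hηs n).continuous.comp continuous_snd).aestronglyMeasurable
      refine this.congr (ae_of_all _ fun z => ?_)
      simp only [Pi.mul_apply, Function.comp]
      ring
    · rw [mul_left_comm, norm_mul]
      exact mul_le_of_le_one_left (norm_nonneg _) (hη1 n z.2)
    · by_cases hz : z ∈ window L a b
      · simpa using ((hηlim z.2 hz.2).mul_const (ψ z)).const_mul (H z)
      · simp [hH0 z hz]
  have l1 := hlim h.locInt hF (hφ.fderiv_apply (1, 0))
  have l2 := (hlim h.locInt_deriv hG hφ).neg
  refine tendsto_nhds_unique l1 (l2.congr fun n => ?_)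
  rw [← h.weak _ (htest n)]
  simp only [hder]

/-- A square integrable function in the window without `x`-dependence, in the weak sense, is
almost everywhere a function of `y`, namely the limit of its mollifications on a vertical line. -/
theorem exists_eq_comp_snd_of_weak_dx_eq_zero {L a b : ℝ} (hL : 0 < L) {F : ℝ × ℝ → ℝ}
    (hF : MemLp F 2 volume) (h : HasWeakDeriv (window L a b) (1, 0) F 0) :
    ∃ w : ℝ → ℝ, ∀ᵐ z : ℝ × ℝ, z ∈ Ico 0 L ×ˢ Ioo a b → F z = w z.2 := by
  have hδ := tendsto_one_div_add_atTop_nhds_zero_nat (𝕜 := ℝ)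
  choose ρ hρ using fun n : ℕ => exists_isMollifier 0 (δ := 1 / ((n : ℝ) + 1)) (by positivity)
  obtain ⟨ns, hns, hlim⟩ := IsMollifier.exists_subseq_tendsto_ae hρ tendsto_const_nhds hδ
    (by norm_num) (by norm_num) hF
  refine ⟨fun y => limUnder atTop fun n => mollify (ρ (ns n)) F (0, y), ?_⟩
  filter_upwards [hlim] with z hz hmem
  refine (Tendsto.limUnder_eq (hz.congr' ?_)).symm
  have hr : 0 < min L (min (z.2 - a) (b - z.2)) :=
    lt_min hL (lt_min (sub_pos.2 hmem.2.1) (sub_pos.2 hmem.2.2))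
  filter_upwards [(hδ.comp hns.tendsto_atTop).eventually (gt_mem_nhds hr)] with n hn
  set d : ℝ := 1 / ((ns n : ℝ) + 1)
  have hn' : d < min L (min (z.2 - a) (b - z.2)) := hn
  rw [lt_min_iff, lt_min_iff] at hn'
  have hsm := (hρ (ns n)).contDiff_mollify h.locInt
  have hd : ∀ t ∈ Ico 0 z.1,
      HasDerivAt (fun t : ℝ => mollify (ρ (ns n)) F (t, z.2)) 0 t := by
    intro t ht
    have h1 : HasDerivAt (fun t : ℝ => (t, z.2)) ((1, 0) : ℝ × ℝ) t :=
      (hasDerivAt_id t).prodMk (hasDerivAt_const t z.2)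
    have h2 := ((hsm.differentiable (by simp) (t, z.2)).hasFDerivAt).comp_hasDerivAt t h1
    have h3 : fderiv ℝ (mollify (ρ (ns n)) F) (t, z.2) (1, 0) = 0 := by
      rw [(hρ (ns n)).fderiv_mollify h]
      · simp [mollify]
      · intro s hs
        rw [sub_zero, mem_closedBall_iff_norm, Prod.norm_def, max_le_iff] at hs
        simp only [Prod.fst_sub, Prod.snd_sub, Real.norm_eq_abs, abs_le] at hs
        have := hmem.1.2
        exact ⟨⟨by linarith [ht.1, hs.1.1], by linarith [ht.2, hs.1.2]⟩,
          by linarith [hs.2.1], by linarith [hs.2.2]⟩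
    rw [h3] at h2
    exact h2
  have h4 := constant_of_has_deriv_right_zero (a := 0) (b := z.1)
    (hsm.continuous.comp (by fun_prop : Continuous fun t : ℝ => (t, z.2))).continuousOn
    fun t ht => (hd t ht).hasDerivWithinAt
  exact h4 z.1 ⟨hmem.1.1, le_rfl⟩

/-! ### Stationary Euler states as window flows -/

theorem dx_dy_comm {φ : ℝ × ℝ → ℝ} (hφ : ContDiff ℝ ∞ φ) (z : ℝ × ℝ) :
    dx (dy φ) z = dy (dx φ) z := by
  have hd : DifferentiableAt ℝ (fderiv ℝ φ) z :=
    (hφ.fderiv_right (m := ∞) (by simp)).differentiable (by simp) z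
  have h1 : ∀ e e' : ℝ × ℝ, fderiv ℝ (fun w => fderiv ℝ φ w e) z e'
      = fderiv ℝ (fderiv ℝ φ) z e' e := by
    intro e e'
    rw [fderiv_clm_apply hd (differentiableAt_const e)]
    simp
  have hs : IsSymmSndFDerivAt ℝ φ z := hφ.contDiffAt.isSymmSndFDerivAt (by
    simpa using (by exact_mod_cast le_top : ((2 : ℕ∞) : WithTop ℕ∞) ≤ ((⊤ : ℕ∞) : WithTop ℕ∞)))
  change fderiv ℝ (fun w => fderiv ℝ φ w (0, 1)) z (1, 0)
    = fderiv ℝ (fun w => fderiv ℝ φ w (1, 0)) z (0, 1)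
  rw [h1, h1, hs.eq]

/-- The weak form of the vorticity equation. By incompressibility
`u₁ ∇u₂ - u₂ ∇u₁ = (u · ∇u₂, -u · ∇u₁) = (-∂_y P, ∂ₓ P)`, which is divergence-free. -/
theorem integral_vorticity_eq_zero {U : Set (ℝ × ℝ)} {u : ℝ × ℝ → ℝ × ℝ}
    {G₁ G₂ : ℝ × ℝ → ℝ × ℝ} {P : ℝ × ℝ → ℝ}
    (hdiv : ∀ᵐ z ∂volume.restrict U, (G₁ z).1 + (G₂ z).2 = 0)
    (hP : HasWeakGradient U P (fun z =>
      (-((u z).1 * (G₁ z).1 + (u z).2 * (G₁ z).2), -((u z).1 * (G₂ z).1 + (u z).2 * (G₂ z).2))))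
    {φ : ℝ × ℝ → ℝ} (hφ : IsTestFunction U φ) :
    ∫ z in U, (((u z).1 * (G₂ z).1 - (u z).2 * (G₁ z).1) * dx φ z
      + ((u z).1 * (G₂ z).2 - (u z).2 * (G₁ z).2) * dy φ z) = 0 := by
  have hdx : IsTestFunction U (dx φ) := hφ.fderiv_apply (1, 0)
  have hdy : IsTestFunction U (dy φ) := hφ.fderiv_apply (0, 1)
  have e1 := hP.weak_x _ hdy
  have e2 := hP.weak_y _ hdx
  have i1 := hP.locInt_x.integrableOn_mul_test hdy
  have i2 := hP.locInt_y.integrableOn_mul_test hdx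
  simp only [dx_dy_comm hφ.smooth] at e1
  simp only at i1 i2 e2
  have e3 : (∫ z in U, -((u z).1 * (G₁ z).1 + (u z).2 * (G₁ z).2) * dy φ z)
      - ∫ z in U, -((u z).1 * (G₂ z).1 + (u z).2 * (G₂ z).2) * dx φ z = 0 := by
    rw [sub_eq_zero, ← neg_inj, ← e1, ← e2]
  rw [← integral_sub i1 i2] at e3
  rw [← e3]
  refine integral_congr_ae ?_
  filter_upwards [hdiv] with z hz
  have h1 : (G₂ z).2 = -(G₁ z).1 := by linarith
  rw [h1]
  ring

theorem memLp_window_of_bound {L a b M : ℝ} {f : ℝ × ℝ → ℝ}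
    (hf : LocallyIntegrableOn f (strip a b)) (hM : ∀ᵐ z, z ∈ strip a b → |f z| ≤ M) :
    MemLp ((window L a b).indicator f) 2 volume := by
  rw [memLp_indicator_iff_restrict (measurableSet_window L a b)]
  have : IsFiniteMeasure (volume.restrict (window L a b)) :=
    ⟨by simpa using (volume_window_ne_top L a b).lt_top⟩
  refine MemLp.of_bound (hf.aestronglyMeasurable.mono_measure
    (Measure.restrict_mono (window_subset_strip L a b) le_rfl)) M ?_
  rw [ae_restrict_iff' (measurableSet_window L a b)]
  filter_upwards [hM] with z hz hmem
  exact hz (window_subset_strip L a b hmem)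

theorem memLp_window_of_eLpNorm_cell {L a b : ℝ} {p : ℝ≥0∞} (hp : 2 < p) {f : ℝ × ℝ → ℝ}
    (hf : LocallyIntegrableOn f (strip a b))
    (hper : ∀ᵐ z, z ∈ strip a b → f (z + (L, 0)) = f z)
    (hfin : eLpNorm f p (volume.restrict (cell L a b)) ≠ ⊤) :
    MemLp ((window L a b).indicator f) 2 volume := by
  obtain ⟨C, hC, hw⟩ := exists_window_const L a b (p := p) (q := 2) (by norm_num)
    (by simpa using hp.le)
  have hm : ∀ {S}, S ⊆ strip a b → AEStronglyMeasurable f (volume.restrict S) := fun hS =>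
    hf.aestronglyMeasurable.mono_measure (Measure.restrict_mono hS le_rfl)
  have := memLp_indicator_of_setLIntegral (measurableSet_window L a b) two_pos
    (hm (window_subset_strip L a b)) (ne_top_of_le_ne_top (ENNReal.mul_ne_top hC hfin)
      (hw f (hm fun z hz => mem_strip.2 hz.2) hper))
  simpa using this

theorem indicator_window_shift {E : Type*} [Zero E] {L a b : ℝ} (hL : 0 < L) {f : ℝ × ℝ → E}
    {z : ℝ × ℝ} (hz : z.1 ∈ Ioo (-(2 * L)) L) (hf : z ∈ strip a b → f (z + (L, 0)) = f z) :
    (window L a b).indicator f (z + (L, 0)) = (window L a b).indicator f z := by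
  by_cases hy : z.2 ∈ Ioo a b
  · have h1 : z ∈ window L a b := ⟨⟨hz.1, by linarith [hz.2]⟩, hy⟩
    have h2 : z + (L, 0) ∈ window L a b := by
      refine ⟨⟨?_, ?_⟩, by simpa using hy⟩ <;> simp only [Prod.fst_add] <;>
        linarith [hz.1, hz.2]
    rw [indicator_of_mem h1, indicator_of_mem h2, hf (mem_strip.2 hy)]
  · have h1 : z ∉ window L a b := fun h => hy h.2
    have h2 : z + (L, 0) ∉ window L a b := fun h => hy (by simpa using h.2)
    rw [indicator_of_notMem h1, indicator_of_notMem h2]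

/-- A stationary Euler state that is bounded, whose first component is bounded away from zero, and
whose gradient is square integrable in the window, restricts to a window flow. The extension of
`u₂` by zero has a weak gradient in the column: for `∂ₓ` this needs no boundary condition, and
for `∂_y` tangency and incompressibility turn `∫ u₂ ∂_y φ` into `-∫ u₁ ∂ₓ φ`. -/
theorem windowFlow_of_euler {L a b σ c M : ℝ} (hL : 0 < L) {u G₁ G₂ : ℝ × ℝ → ℝ × ℝ}
    {P : ℝ × ℝ → ℝ} (hσ : |σ| = 1) (hc : 0 < c) (hper : IsXPeriodic L a b u)
    (h₁ : HasWeakGradient (strip a b) (fun z => (u z).1) G₁)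
    (h₂ : HasWeakGradient (strip a b) (fun z => (u z).2) G₂)
    (hdiv : ∀ᵐ z ∂volume.restrict (strip a b), (G₁ z).1 + (G₂ z).2 = 0)
    (hP : HasWeakGradient (strip a b) P (fun z =>
      (-((u z).1 * (G₁ z).1 + (u z).2 * (G₁ z).2), -((u z).1 * (G₂ z).1 + (u z).2 * (G₂ z).2))))
    (htan : ∀ φ, IsTestFunction univ φ →
      ∫ z in strip a b, ((u z).1 * dx φ z + (u z).2 * dy φ z) = 0)
    (b₁ : ∀ᵐ z, z ∈ strip a b → |(u z).1| ≤ M) (b₂ : ∀ᵐ z, z ∈ strip a b → |(u z).2| ≤ M)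
    (hlow : ∀ᵐ z, z ∈ strip a b → c ≤ σ * (u z).1) (hM : 0 ≤ M)
    (m₁x : MemLp ((window L a b).indicator fun z => (G₁ z).1) 2 volume)
    (m₁y : MemLp ((window L a b).indicator fun z => (G₁ z).2) 2 volume)
    (m₂x : MemLp ((window L a b).indicator fun z => (G₂ z).1) 2 volume)
    (m₂y : MemLp ((window L a b).indicator fun z => (G₂ z).2) 2 volume) :
    WindowFlow L a b σ c M ((window L a b).indicator fun z => (u z).1)
      ((window L a b).indicator fun z => (u z).2)
      ((window L a b).indicator fun z => (G₁ z).1) ((window L a b).indicator fun z => (G₁ z).2)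
      ((window L a b).indicator fun z => (G₂ z).1)
      ((window L a b).indicator fun z => (G₂ z).2) := by
  set Q := window L a b with hQ
  have hsub : Q ⊆ strip a b := window_subset_strip L a b
  have hms := (isOpen_strip a b).measurableSet
  have mA : MemLp (Q.indicator fun z => (u z).1) 2 volume := memLp_window_of_bound h₁.locInt b₁
  have mV : MemLp (Q.indicator fun z => (u z).2) 2 volume := memLp_window_of_bound h₂.locInt b₂
  have li : ∀ {F : ℝ × ℝ → ℝ}, MemLp F 2 volume → LocallyIntegrable F :=
    fun hF => hF.locallyIntegrable (by norm_num)
  obtain ⟨wAx, wAy⟩ := h₁.hasWeakDeriv_window (li mA) (li m₁x) (li m₁y)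
  obtain ⟨wVx, -⟩ := h₂.hasWeakDeriv_window (li mV) (li m₂x) (li m₂y)
  have z0 : ∀ f : ℝ × ℝ → ℝ, ∀ z ∉ Q, Q.indicator f z = 0 := fun f z hz =>
    indicator_of_notMem hz f
  have hdivQ : ∀ᵐ z, Q.indicator (fun z => (G₁ z).1) z + Q.indicator (fun z => (G₂ z).2) z = 0 := by
    filter_upwards [(ae_restrict_iff' hms).1 hdiv] with z hz
    by_cases hmem : z ∈ Q
    · simpa [hmem] using hz (hsub hmem)
    · simp [hmem]
  have tangent : ∀ φ, IsTestFunction (column L) φ →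
      ∫ z, (Q.indicator (fun z => (u z).1) z * dx φ z
        + Q.indicator (fun z => (u z).2) z * dy φ z) = 0 := by
    intro φ hφ
    rw [← htan φ (hφ.mono (subset_univ _)), ← integral_indicator hms]
    refine integral_congr_ae (ae_of_all _ fun z => ?_)
    by_cases hz : z ∈ Q
    · rw [indicator_of_mem (hsub hz)]
      simp only [indicator_of_mem hz]
    · by_cases hzs : z ∈ strip a b
      · have hzc : z ∉ column L := fun h => hz ⟨h.1, mem_strip.1 hzs⟩
        have d1 : dx φ z = 0 := (hφ.fderiv_apply (1, 0)).eq_zero_of_notMem hzc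
        have d2 : dy φ z = 0 := (hφ.fderiv_apply (0, 1)).eq_zero_of_notMem hzc
        rw [indicator_of_mem hzs]
        simp only [d1, d2, mul_zero, add_zero]
      · rw [indicator_of_notMem hzs]
        simp only [indicator_of_notMem hz, zero_mul, add_zero]
  have bound : ∀ {f : ℝ × ℝ → ℝ}, (∀ᵐ z, z ∈ strip a b → |f z| ≤ M) →
      ∀ᵐ z, |Q.indicator f z| ≤ M := by
    intro f hf
    filter_upwards [hf] with z hz
    by_cases hmem : z ∈ Q
    · rw [indicator_of_mem hmem]
      exact hz (hsub hmem)
    · rw [indicator_of_notMem hmem, abs_zero]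
      exact hM
  have wAx' := wAx.column_of_window (z0 _) (z0 _)
  refine ⟨hσ, hc, mA, mV, m₁x, m₁y, m₂x, m₂y, bound b₁, bound b₂, ?_, z0 _, z0 _, wAx, wAy,
    wVx.column_of_window (z0 _) (z0 _), ⟨li mV, li m₂y, fun φ hφ => ?_⟩, hdivQ, ?_, tangent, ?_⟩
  · filter_upwards [hlow] with z hz hmem
    rw [indicator_of_mem hmem]
    exact hz (hsub hmem)
  · have e1 := tangent φ hφ
    have i1 := (hφ.fderiv_apply (1, 0)).integrable_mul (li mA)
    have i2 := (hφ.fderiv_apply (0, 1)).integrable_mul (li mV)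
    have e2 := integral_add i1 i2
    have e3 := wAx'.weak φ hφ
    have e4 : ∫ z, Q.indicator (fun z => (G₁ z).1) z * φ z
        = -∫ z, Q.indicator (fun z => (G₂ z).2) z * φ z := by
      rw [← integral_neg]
      refine integral_congr_ae ?_
      filter_upwards [hdivQ] with z hz
      rw [eq_neg_of_add_eq_zero_left hz]
      ring
    simp only [dx, dy] at e1
    linarith
  · filter_upwards [h₁.ae_periodic (L := L) fun x y hy => congrArg Prod.fst (hper x y hy),
      h₂.ae_periodic (L := L) fun x y hy => congrArg Prod.snd (hper x y hy)] with z p1 p2 hz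
    have p0 : z ∈ strip a b → u (z + (L, 0)) = u z := fun hzs => by
      simpa [Prod.add_def] using hper z.1 z.2 (mem_strip.1 hzs)
    exact ⟨indicator_window_shift hL hz fun hzs => by rw [p0 hzs],
      indicator_window_shift hL hz fun hzs => by rw [p0 hzs],
      indicator_window_shift hL hz fun hzs => by rw [p1 hzs],
      indicator_window_shift hL hz fun hzs => by rw [p2 hzs]⟩
  · intro φ hφ
    rw [← integral_vorticity_eq_zero hdiv hP (hφ.mono hsub),
      ← integral_indicator hms]
    refine integral_congr_ae (ae_of_all _ fun z => ?_)
    by_cases hz : z ∈ Q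
    · rw [indicator_of_mem (hsub hz)]
      simp only [indicator_of_mem hz]
    · have d1 : dx φ z = 0 := (hφ.fderiv_apply (1, 0)).eq_zero_of_notMem hz
      have d2 : dy φ z = 0 := (hφ.fderiv_apply (0, 1)).eq_zero_of_notMem hz
      have d3 : ((u z).1 * (G₂ z).1 - (u z).2 * (G₁ z).1) * dx φ z
          + ((u z).1 * (G₂ z).2 - (u z).2 * (G₁ z).2) * dy φ z = 0 := by
        rw [d1, d2, mul_zero, mul_zero, add_zero]
      simp only [indicator_of_notMem hz, d1, d2, mul_zero, add_zero]
      rw [eq_comm, indicator_apply_eq_zero]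
      exact fun _ => d3

/-! ### Flows near a shear flow -/

theorem exists_gradient_of_sobolevNorm_lt {L a b : ℝ} {p r : ℝ≥0∞} {f : ℝ × ℝ → ℝ}
    (h : sobolevNorm L a b p f < r) :
    ∃ g, HasWeakGradient (strip a b) f g ∧
      eLpNorm f p (volume.restrict (cell L a b))
        + eLpNorm (fun z => (g z).1) p (volume.restrict (cell L a b))
        + eLpNorm (fun z => (g z).2) p (volume.restrict (cell L a b)) < r := by
  simpa [sobolevNorm, iInf_lt_iff] using h

/-- A continuous profile bounded away from zero has a constant sign `σ`. -/
theorem exists_sign_mul_ge {a b m : ℝ} (hm : 0 < m) {v : ℝ → ℝ}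
    (hv : ContinuousOn v (Icc a b)) (h : ∀ y ∈ Icc a b, m ≤ |v y|) :
    ∃ σ : ℝ, |σ| = 1 ∧ ∀ y ∈ Icc a b, m ≤ σ * v y := by
  by_cases hpos : ∀ y ∈ Icc a b, 0 ≤ v y
  · exact ⟨1, abs_one, fun y hy => by simpa [abs_of_nonneg (hpos y hy)] using h y hy⟩
  · push Not at hpos
    obtain ⟨y₀, hy₀, hneg⟩ := hpos
    refine ⟨-1, by simp, fun y hy => ?_⟩
    have hle : v y ≤ 0 := by
      by_contra! hlt
      obtain ⟨y₁, h₁, e₁⟩ := isPreconnected_Icc.intermediate_value hy₀ hy hv ⟨hneg.le, hlt.le⟩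
      have := h y₁ h₁
      rw [e₁, abs_zero] at this
      linarith
    simpa [abs_of_nonpos hle] using h y hy

theorem ae_abs_le_of_sobolev_bound {S : Set (ℝ × ℝ)} {f : ℝ × ℝ → ℝ} {C N : ℝ≥0∞} {ε m : ℝ}
    (hm : 0 ≤ m) (hC : C * ENNReal.ofReal ε ≤ ENNReal.ofReal m) (hN : N ≤ ENNReal.ofReal ε)
    (h : ∀ᵐ z, z ∈ S → ‖f z‖ₑ ≤ C * N) : ∀ᵐ z, z ∈ S → |f z| ≤ m := by
  filter_upwards [h] with z hz hmem
  have h1 := (hz hmem).trans ((mul_le_mul_right hN C).trans hC)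
  rw [← ofReal_norm, Real.norm_eq_abs] at h1
  exact (ENNReal.ofReal_le_ofReal_iff hm).1 h1

/-- An `x`-periodic tangential field with vanishing second component is a shear flow: tangency
becomes `∫ u₁ ∂ₓ φ = 0`. -/
theorem isShearFlow_of_snd_ae_eq_zero {L a b : ℝ} (hL : 0 < L) {u : ℝ × ℝ → ℝ × ℝ}
    (hper : IsXPeriodic L a b u)
    (htan : ∀ φ, IsTestFunction univ φ →
      ∫ z in strip a b, ((u z).1 * dx φ z + (u z).2 * dy φ z) = 0)
    (hu : MemLp ((window L a b).indicator fun z => (u z).1) 2 volume)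
    (h0 : ∀ᵐ z, z ∈ strip a b → (u z).2 = 0) : IsShearFlow a b u := by
  have hms := (isOpen_strip a b).measurableSet
  have hsub := window_subset_strip L a b
  have hshift : ∀ z ∈ strip a b, u (z + (L, 0)) = u z := fun z hz => by
    simpa [Prod.add_def] using hper z.1 z.2 (mem_strip.1 hz)
  have hli : LocallyIntegrable ((window L a b).indicator fun z => (u z).1) :=
    hu.locallyIntegrable (by norm_num)
  have hweak : HasWeakDeriv (window L a b) (1, 0)
      ((window L a b).indicator fun z => (u z).1) 0 := by
    refine ⟨hli, locallyIntegrable_zero, fun φ hφ => ?_⟩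
    rw [integral_indicator_mul_eq hms hsub _ fun z hz =>
      (hφ.fderiv_apply _).eq_zero_of_notMem hz]
    simp only [Pi.zero_apply, zero_mul, integral_zero, neg_zero]
    refine Eq.trans (integral_congr_ae ?_) (htan φ (hφ.mono (subset_univ _)))
    filter_upwards [(ae_restrict_iff' hms).2 h0] with z hz
    simp [hz, dx]
  obtain ⟨w, hw⟩ := exists_eq_comp_snd_of_weak_dx_eq_zero hL hu hweak
  refine ⟨w, (ae_restrict_iff' hms).2 (ae_strip_of_ae_cell hL (fun z hz => ?_) ?_)⟩
  · rw [hshift z hz]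
    simp [shear]
  · filter_upwards [hw, h0] with z h1 h2 hz
    have hz' : z ∈ window L a b :=
      ⟨⟨by linarith [hz.1.1], by linarith [hz.1.2]⟩, hz.2⟩
    have h3 := h1 hz
    rw [indicator_of_mem hz'] at h3
    exact Prod.ext h3 (h2 (hsub hz'))

end ChannelFlow

theorem mainTheorem6 (L a b : ℝ) (hL : 0 < L) (hab : a < b) (p : ℝ≥0∞) (hp : 2 < p)
    (m K : ℝ) (hm : 0 < m) :
    ∃ ε : ℝ, 0 < ε ∧
      ∀ v : ℝ → ℝ, ContDiffOn ℝ 1 v (Icc a b) → m ≤ ⨅ y : Icc a b, |v y| →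
        c1Norm a b v ≤ K →
        ∀ u : ℝ × ℝ → ℝ × ℝ, IsStationaryEuler L a b u →
          sobolevNormVec L a b p (u - shear v) < ENNReal.ofReal ε →
          IsShearFlow a b u := by
  obtain ⟨C, hC, hsup⟩ := exists_sup_const hL hab hp
  -- The deviation is then at most `m / 2` in the sup norm, so `|u₁| ≥ m / 2`.
  refine ⟨m / 2 / (C.toReal + 1), by positivity, fun v hv hvm _ u hu hclose => ?_⟩
  set ε := m / 2 / (C.toReal + 1)
  have hCε : C * ENNReal.ofReal ε ≤ ENNReal.ofReal (m / 2) := by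
    rw [← ENNReal.ofReal_toReal hC, ← ENNReal.ofReal_mul ENNReal.toReal_nonneg]
    refine ENNReal.ofReal_le_ofReal ?_
    have : (C.toReal + 1) * ε = m / 2 := mul_div_cancel₀ _ (by positivity)
    have : 0 < ε := by positivity
    linarith
  obtain ⟨hper, ⟨G₁, G₂, P, h₁, h₂, hdiv, -, hP⟩, htan⟩ := hu
  have hshift : ∀ z ∈ strip a b, u (z + (L, 0)) = u z := fun z hz => by
    simpa [Prod.add_def] using hper z.1 z.2 (mem_strip.1 hz)
  obtain ⟨g₁, hg₁, N₁⟩ := exists_gradient_of_sobolevNorm_lt (le_self_add.trans_lt hclose)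
  obtain ⟨g₂, hg₂, N₂⟩ := exists_gradient_of_sobolevNorm_lt (le_add_self.trans_lt hclose)
  have hp₁ : IsXPeriodic L a b fun z => ((u - shear v) z).1 := fun x y hy => by
    simp [shear, hper x y hy]
  have hp₂ : IsXPeriodic L a b fun z => ((u - shear v) z).2 := fun x y hy => by
    simp [shear, hper x y hy]
  have s₁ := ae_abs_le_of_sobolev_bound (by positivity) hCε N₁.le (hsup _ _ hp₁ hg₁ N₁.ne_top)
  have s₂ := ae_abs_le_of_sobolev_bound (by positivity) hCε N₂.le (hsup _ _ hp₂ hg₂ N₂.ne_top)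
  have hvlow : ∀ y ∈ Icc a b, m ≤ |v y| := fun y hy => hvm.trans
    (ciInf_le ⟨0, by rintro _ ⟨t, rfl⟩; exact abs_nonneg _⟩ (⟨y, hy⟩ : Icc a b))
  obtain ⟨σ, hσ, hσv⟩ := exists_sign_mul_ge hm hv.continuousOn hvlow
  obtain ⟨M₀, hM₀⟩ := isCompact_Icc.exists_bound_of_continuousOn hv.continuousOn
  obtain ⟨M₁, hM₁⟩ := isCompact_Icc.exists_bound_of_continuousOn
    (hv.continuousOn_derivWithin (uniqueDiffOn_Icc hab) le_rfl)
  have hIcc : ∀ z ∈ strip a b, z.2 ∈ Icc a b := fun z hz => Ioo_subset_Icc_self (mem_strip.1 hz)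
  have hM₀0 : 0 ≤ M₀ := (norm_nonneg _).trans (hM₀ a ⟨le_rfl, hab.le⟩)
  have hshear := HasWeakGradient.of_contDiffOn hab hv
  have hms := (isOpen_strip a b).measurableSet
  -- The given gradients agree with the ones that realize the Sobolev norm.
  have hG₁ : ∀ᵐ z, z ∈ strip a b → (G₁ z - (0, derivWithin v (Icc a b) z.2)) = g₁ z :=
    (h₁.sub hshear).ae_unique (isOpen_strip a b) hg₁ fun z _ => rfl
  have hG₂ : ∀ᵐ z, z ∈ strip a b → G₂ z = g₂ z :=
    h₂.ae_unique (isOpen_strip a b) hg₂ fun z _ => by simp [shear]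
  have fin : ∀ {x y z : ℝ≥0∞}, x + y + z < ENNReal.ofReal ε → y ≠ ⊤ ∧ z ≠ ⊤ := fun h =>
    ⟨fun e => by simp [e] at h, fun e => by simp [e] at h⟩
  have q₁ := hg₁.ae_periodic hp₁
  have q₂ := hg₂.ae_periodic hp₂
  have n₁x := memLp_window_of_eLpNorm_cell hp hg₁.locInt_x
    (q₁.mono fun z hz hmem => by rw [hz hmem]) (fin N₁).1
  have n₁y := memLp_window_of_eLpNorm_cell hp hg₁.locInt_y
    (q₁.mono fun z hz hmem => by rw [hz hmem]) (fin N₁).2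
  have n₂x := memLp_window_of_eLpNorm_cell hp hg₂.locInt_x
    (q₂.mono fun z hz hmem => by rw [hz hmem]) (fin N₂).1
  have n₂y := memLp_window_of_eLpNorm_cell hp hg₂.locInt_y
    (q₂.mono fun z hz hmem => by rw [hz hmem]) (fin N₂).2
  have nv := memLp_window_of_bound (L := L) hshear.locInt_y
    (ae_of_all _ fun z hz => hM₁ z.2 (hIcc z hz))
  have hsub := window_subset_strip L a b
  have ind : ∀ {f g : ℝ × ℝ → ℝ}, (∀ᵐ z, z ∈ strip a b → f z = g z) →
      (window L a b).indicator f =ᵐ[volume] (window L a b).indicator g := by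
    intro f g h
    filter_upwards [h] with z hz
    by_cases hmem : z ∈ window L a b
    · rw [indicator_of_mem hmem, indicator_of_mem hmem, hz (hsub hmem)]
    · rw [indicator_of_notMem hmem, indicator_of_notMem hmem]
  have m₁x : MemLp ((window L a b).indicator fun z => (G₁ z).1) 2 volume := by
    refine n₁x.ae_eq (ind ?_)
    filter_upwards [hG₁] with z hz hmem
    simp [← hz hmem]
  have m₁y : MemLp ((window L a b).indicator fun z => (G₁ z).2) 2 volume := by
    have := n₁y.add nv
    rw [← indicator_add'] at this
    refine this.ae_eq (ind ?_)
    filter_upwards [hG₁] with z hz hmem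
    simp [← hz hmem]
  have m₂x : MemLp ((window L a b).indicator fun z => (G₂ z).1) 2 volume :=
    n₂x.ae_eq (ind (hG₂.mono fun z hz hmem => by rw [hz hmem]))
  have m₂y : MemLp ((window L a b).indicator fun z => (G₂ z).2) 2 volume :=
    n₂y.ae_eq (ind (hG₂.mono fun z hz hmem => by rw [hz hmem]))
  have b₁ : ∀ᵐ z, z ∈ strip a b → |(u z).1| ≤ M₀ + m / 2 := by
    filter_upwards [s₁] with z hz hmem
    have h3 := abs_le.1 (hz hmem)
    have h4 := abs_le.1 (hM₀ z.2 (hIcc z hmem))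
    simp only [Pi.sub_apply, Prod.fst_sub, shear] at h3
    exact abs_le.2 ⟨by linarith, by linarith⟩
  have b₂ : ∀ᵐ z, z ∈ strip a b → |(u z).2| ≤ M₀ + m / 2 := by
    filter_upwards [s₂] with z hz hmem
    have h3 := hz hmem
    simp only [Pi.sub_apply, Prod.snd_sub, shear, sub_zero] at h3
    linarith
  have hlow : ∀ᵐ z, z ∈ strip a b → m / 2 ≤ σ * (u z).1 := by
    filter_upwards [s₁] with z hz hmem
    have h3 := hz hmem
    have h4 := hσv z.2 (hIcc z hmem)
    simp only [Pi.sub_apply, Prod.fst_sub, shear] at h3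
    have h5 : |σ * ((u z).1 - v z.2)| ≤ m / 2 := by rwa [abs_mul, hσ, one_mul]
    linarith [(abs_le.1 h5).1]
  have hflow := windowFlow_of_euler hL hσ (half_pos hm) hper h₁ h₂ hdiv hP htan b₁ b₂ hlow
    (by positivity) m₁x m₁y m₂x m₂y
  refine isShearFlow_of_snd_ae_eq_zero hL hper htan hflow.memLp_A
    (ae_strip_of_ae_cell hL (fun z hz => by rw [hshift z hz]) ?_)
  filter_upwards [hflow.ae_V_eq_zero hL hab] with z hz hmem
  have hz' : z ∈ window L a b :=
    ⟨⟨by linarith [hmem.1.1], by linarith [hmem.1.2]⟩, hmem.2⟩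
  rw [← hz ⟨by linarith [hmem.1.1], hmem.1.2⟩, indicator_of_mem hz']
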